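/- **Conventions.** $SMC$ denotes the category whose objects are the small symmetric monoidal categories and whose arrows (the 1-cells) are the symmetric (lax) monoidal functors $F=(F,F^0:I\to F(I),F^2_{x,y}:F(x)\otimes F(y)\to F(x\otimes y))$, with composition $GF=(G\circ F,\;G(F^0)\circ G^0,\;G(F^2)\circ G^2)$ and identities with identity structure arrows. For $A,B$ in $SMC$, $[A,B]$ is the symmetric monoidal category of symmetric monoidal functors $A\to B$ and monoidal natural transformations, with pointwise structure: $(F\otimes G)(a)=F(a)\otimes G(a)$, the unit is the constant functor at $I$, and the canonical isomorphisms are those of $B$ pointwise. **Duality.** For a symmetric monoidal functor $F:A\to[B,C]$, its dual $F^*:B\to[A,C]$ is the symmetric monoidal functor obtained by exchanging the two arguments: $F^*(b)(a)=F(a)(b)$, $F^*(b)(f)=F(f)_b$, $F^*(b)^0=(F^0)_b$, $(F^*(b)^2)_{a,a'}=(F^2_{a,a'})_b$, $F^*(g)_a=F(a)(g)$, $((F^*)^0)_a=F(a)^0$ and $((F^*)^2_{b,b'})_a=(F(a)^2)_{b,b'}$. **Tensor.** For $A,B$ in $SMC$, $A\otimes B$ is the following small symmetric monoidal category. Its objects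 are the words freely generated by the pairs $a\otimes b$ ($a\in A$, $b\in B$) from a constant $I$ and a binary operation $\otimes$. Its arrows are the formal composites of generating arrows modulo a congruence. The generating arrows are the associativity, unit and symmetry arrows (with formal inverses), the arrows $$\alpha_b:I\to I_A\otimes b,\quad \beta_a:I\to a\otimes I_B,\quad \gamma_{a,a',b}:(a\otimes b)\otimes(a'\otimes b)\to(a\otimes a')\otimes b,\quad \delta_{a,b,b'}:(a\otimes b)\otimes(a\otimes b')\to a\otimes(b\otimes b'),$$ the arrows $f\otimes b:a\otimes b\to a'\otimes b$ and $a\otimes g:a\otimes b\to a\otimes b'$ for $f:a\to a'$ in $A$ and $g:b\to b'$ in $B$, and all the arrows obtained from these by applying $X\otimes-$ and $-\otimes X$ repeatedly. The congruence is the smallest one, stable under all $X\otimes-$ and $-\otimes X$, such that: $\otimes$ is a bifunctor and the canonical arrows are natural isomorphisms satisfying the axioms of a symmetric monoidal category; $a\otimes-$ and $-\otimes b$ are functorial and $(a'\otimes g)(f\otimes b)=(f\otimes b')(a\otimes g)$; $\alpha,\beta,\gamma,\delta$ are natural in each variable; for each $a$, $(\beta_a,\delta_{a,-,-})$ makes $a\otimes-:B\to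 A\otimes B$ a symmetric monoidal functor; for each $b$, $(\alpha_b,\gamma_{-,-,b})$ makes $-\otimes b:A\to A\otimes B$ a symmetric monoidal functor; and, with $\cong$ denoting canonical isomorphisms, $$\delta_{I_A,b,b'}(\alpha_b\otimes\alpha_{b'})=\alpha_{b\otimes b'}\circ(I\otimes I\cong I),\qquad \gamma_{a,a',I_B}(\beta_a\otimes\beta_{a'})=\beta_{a\otimes a'}\circ(I\otimes I\cong I),\qquad \beta_{I_A}=\alpha_{I_B},$$ $$\gamma_{a,a',b\otimes b'}\,(\delta_{a,b,b'}\otimes\delta_{a',b,b'})=\delta_{a\otimes a',b,b'}\,(\gamma_{a,a',b}\otimes\gamma_{a,a',b'})\circ(\cong),$$ where the last $\cong$ interchanges the two middle factors of $((a\otimes b)\otimes(a\otimes b'))\otimes((a'\otimes b)\otimes(a'\otimes b'))$. There is a symmetric monoidal functor $\eta_{A,B}:A\to[B,A\otimes B]$ with $\eta(a)(b)=a\otimes b$, $\eta(a)(g)=a\otimes g$, $\eta(a)^0=\beta_a$, $\eta(a)^2_{b,b'}=\delta_{a,b,b'}$, $\eta(f)_b=f\otimes b$, $(\eta^0)_b=\alpha_b$,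 $(\eta^2_{a,a'})_b=\gamma_{a,a',b}$. It is universal: every symmetric monoidal functor $F:A\to[B,C]$ equals $[B,\bar F]\circ\eta_{A,B}$ for a unique strict symmetric monoidal functor $\bar F:A\otimes B\to C$. Explicitly, $\bar F(a\otimes b)=F(a)(b)$, $\bar F(I)=I$, $\bar F(X\otimes Y)=\bar F X\otimes\bar F Y$; and $\bar F$ sends canonical arrows to canonical arrows, $\alpha_b,\beta_a,\gamma_{a,a',b},\delta_{a,b,b'}$ to $(F^0)_b,\ F(a)^0,\ (F^2_{a,a'})_b,\ (F(a)^2)_{b,b'}$, $f\otimes b$ to $F(f)_b$, $a\otimes g$ to $F(a)(g)$, and $X\otimes p$, $p\otimes X$ to $\bar FX\otimes\bar Fp$, $\bar Fp\otimes\bar FX$. **Symmetry.** Let $S_{A,B}:A\otimes B\to B\otimes A$ be the strict symmetric monoidal functor corresponding under this universal property to the dual $(\eta_{B,A})^*:A\to[B,B\otimes A]$ of $\eta_{B,A}:B\to[A,B\otimes A]$. **Statement.** For all small symmetric monoidal categories $A$ and $B$, $$S_{B,A}\circ S_{A,B}=\mathrm{id}_{A\otimes B}$$ in $SMC$, that is,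 as symmetric monoidal functors $A\otimes B\to A\otimes B$ (equality of the underlying functors and of the structure arrows). -/

import Mathlib

open CategoryTheory MonoidalCategory Functor.LaxMonoidal

universe u

namespace SymMon

section Hom

variable {A B C : Type u} [SmallCategory A] [MonoidalCategory A] [SymmetricCategory A]
  [SmallCategory B] [MonoidalCategory B] [SymmetricCategory B]
  [SmallCategory C] [MonoidalCategory C] [SymmetricCategory C]

/-! ### 1-cells: symmetric (lax) monoidal functors and their composition -/

/-- The identity symmetric monoidal functor. -/
def idFun (A : Type u) [SmallCategory A] [MonoidalCategory A] [SymmetricCategory A] :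
    LaxBraidedFunctor A A :=
  LaxBraidedFunctor.of (𝟭 A)

/-- The composite `G ∘ F` of symmetric monoidal functors, with
`(GF)⁰ = G(F⁰) ∘ G⁰` and `(GF)² = G(F²) ∘ G²`. -/
def compFun (F : LaxBraidedFunctor A B) (G : LaxBraidedFunctor B C) : LaxBraidedFunctor A C :=
  LaxBraidedFunctor.of (F.toFunctor ⋙ G.toFunctor)

/-- Two symmetric monoidal functors with the same underlying functor are equal as soon as their
structure arrows are. -/
theorem fun_ext_of_toFunctor_eq (F : A ⥤ B) (h₁ h₂ : F.LaxBraided)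
    (hε : h₁.ε = h₂.ε) (hμ : h₁.μ = h₂.μ) :
    (⟨F, h₁⟩ : LaxBraidedFunctor A B) = ⟨F, h₂⟩ := by
  have : h₁ = h₂ := by
    obtain @⟨⟨ε₁, μ₁⟩, _⟩ := h₁
    obtain @⟨⟨ε₂, μ₂⟩, _⟩ := h₂
    change ε₁ = ε₂ at hε
    change μ₁ = μ₂ at hμ
    subst hε hμ
    rfl
  rw [this]

theorem comp_idFun (F : LaxBraidedFunctor A B) : compFun F (idFun B) = F := by
  obtain ⟨F, h⟩ := F
  refine fun_ext_of_toFunctor_eq F _ _ ?_ ?_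
  · change 𝟙 _ ≫ h.ε = _
    simp
  · funext X Y
    change 𝟙 _ ≫ h.μ X Y = _
    simp

theorem id_compFun (F : LaxBraidedFunctor A B) : compFun (idFun A) F = F := by
  obtain ⟨F, h⟩ := F
  refine fun_ext_of_toFunctor_eq F _ _ ?_ ?_
  · change h.ε ≫ F.map (𝟙 _) = _
    simp
  · funext X Y
    change h.μ X Y ≫ F.map (𝟙 _) = _
    simp

theorem compFun_assoc {D : Type u} [SmallCategory D] [MonoidalCategory D] [SymmetricCategory D]
    (F : LaxBraidedFunctor A B) (G : LaxBraidedFunctor B C) (H : LaxBraidedFunctor C D) :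
    compFun (compFun F G) H = compFun F (compFun G H) := by
  obtain ⟨F, hF⟩ := F
  obtain ⟨G, hG⟩ := G
  obtain ⟨H, hH⟩ := H
  refine fun_ext_of_toFunctor_eq (F ⋙ G ⋙ H) _ _ ?_ ?_
  · change hH.ε ≫ H.map (hG.ε ≫ G.map hF.ε) = (hH.ε ≫ H.map hG.ε) ≫ H.map (G.map hF.ε)
    simp
  · funext X Y
    change hH.μ _ _ ≫ H.map (hG.μ _ _ ≫ G.map (hF.μ X Y)) =
      (hH.μ _ _ ≫ H.map (hG.μ _ _)) ≫ H.map (G.map (hF.μ X Y))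
    simp

/-! ### The internal hom `[A, B]`

Its underlying category is `LaxBraidedFunctor A B`: symmetric monoidal functors `A → B` and monoidal
natural transformations. -/

/-- Constructor for monoidal natural transformations. -/
def mkNat {F G : LaxBraidedFunctor A B} (app : ∀ a : A, F.obj a ⟶ G.obj a)
    (nat : ∀ ⦃a a' : A⦄ (f : a ⟶ a'), F.map f ≫ app a' = app a ≫ G.map f)
    (unit : ε F.toFunctor ≫ app (𝟙_ A) = ε G.toFunctor)
    (tensor : ∀ a a' : A, μ F.toFunctor a a' ≫ app (a ⊗ a') =
      (app a ⊗ₘ app a') ≫ μ G.toFunctor a a') : F ⟶ G :=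
  ⟨⟨{ app := app, naturality := nat }, { unit := unit, tensor := tensor }⟩⟩

/-- The component at `a` of a monoidal natural transformation. -/
def napp {F G : LaxBraidedFunctor A B} (σ : F ⟶ G) (a : A) : F.obj a ⟶ G.obj a :=
  σ.hom.hom.app a

@[simp] theorem napp_mkNat {F G : LaxBraidedFunctor A B} (app nat unit tensor) (a : A) :
    napp (mkNat (F := F) (G := G) app nat unit tensor) a = app a := rfl

theorem nat_ext {F G : LaxBraidedFunctor A B} {σ τ : F ⟶ G} (h : ∀ a, napp σ a = napp τ a) :
    σ = τ :=
  LaxBraidedFunctor.hom_ext (NatTrans.ext (funext h))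

@[simp] theorem napp_id (F : LaxBraidedFunctor A B) (a : A) : napp (𝟙 F) a = 𝟙 (F.obj a) := rfl

@[simp] theorem napp_comp {F G H : LaxBraidedFunctor A B} (σ : F ⟶ G) (τ : G ⟶ H) (a : A) :
    napp (σ ≫ τ) a = napp σ a ≫ napp τ a := rfl

theorem napp_naturality {F G : LaxBraidedFunctor A B} (σ : F ⟶ G) {a a' : A} (f : a ⟶ a') :
    F.map f ≫ napp σ a' = napp σ a ≫ G.map f := σ.hom.hom.naturality f

theorem napp_unit {F G : LaxBraidedFunctor A B} (σ : F ⟶ G) :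
    ε F.toFunctor ≫ napp σ (𝟙_ A) = ε G.toFunctor := σ.hom.isMonoidal.unit

theorem napp_tensor {F G : LaxBraidedFunctor A B} (σ : F ⟶ G) (a a' : A) :
    μ F.toFunctor a a' ≫ napp σ (a ⊗ a') = (napp σ a ⊗ₘ napp σ a') ≫ μ G.toFunctor a a' :=
  σ.hom.isMonoidal.tensor a a'

/-- The middle-four interchange is compatible with the symmetry. -/
theorem tensorμ_braiding (a b c d : A) :
    tensorμ a b c d ≫ ((β_ a c).hom ⊗ₘ (β_ b d).hom) =
      (β_ (a ⊗ b) (c ⊗ d)).hom ≫ tensorμ c d a b := by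
  have e : (β_ d a).hom = (β_ a d).inv := SymmetricCategory.braiding_swap_eq_inv_braiding _ _
  simp only [tensorμ, BraidedCategory.braiding_tensor_left_hom,
    BraidedCategory.braiding_tensor_right_hom, e]
  calc _ = 𝟙 _ ⊗≫ a ◁ (β_ b c).hom ▷ d ⊗≫ ((β_ a c).hom ▷ (b ⊗ d) ≫
              (c ⊗ a) ◁ (β_ b d).hom) ⊗≫ 𝟙 _ := by
        rw [MonoidalCategory.tensorHom_def]; monoidal
    _ = 𝟙 _ ⊗≫ a ◁ (β_ b c).hom ▷ d ⊗≫ ((β_ a c).hom ▷ (b ⊗ d) ≫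
              (c ⊗ a) ◁ (β_ b d).hom) ⊗≫
          c ◁ ((β_ a d).hom ≫ (β_ a d).inv) ▷ b ⊗≫ 𝟙 _ := by
        rw [Iso.hom_inv_id]; monoidal
    _ = _ := by monoidal

theorem tensorμ_braiding' (a b c d : A) :
    tensorμ a b c d ≫ (β_ (a ⊗ c) (b ⊗ d)).hom =
      ((β_ a b).hom ⊗ₘ (β_ c d).hom) ≫ tensorμ b a d c := by
  have e : (β_ c b).hom = (β_ b c).inv := SymmetricCategory.braiding_swap_eq_inv_braiding _ _
  simp only [tensorμ, BraidedCategory.braiding_tensor_left_hom,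
    BraidedCategory.braiding_tensor_right_hom, e]
  calc _ = 𝟙 _ ⊗≫ a ◁ ((β_ b c).hom ≫ (β_ b c).inv) ▷ d ⊗≫ ((β_ a b).hom ▷ (c ⊗ d) ≫
             (b ⊗ a) ◁ (β_ c d).hom) ⊗≫ b ◁ (β_ a d).hom ▷ c ⊗≫ 𝟙 _ := by
        monoidal
    _ = 𝟙 _ ⊗≫ ((β_ a b).hom ▷ (c ⊗ d) ≫
             (b ⊗ a) ◁ (β_ c d).hom) ⊗≫ b ◁ (β_ a d).hom ▷ c ⊗≫ 𝟙 _ := by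
        rw [Iso.hom_inv_id]; monoidal
    _ = _ := by rw [MonoidalCategory.tensorHom_def]; monoidal

/-- The middle-four interchange is an involution. -/
theorem tensorμ_tensorμ (a b c d : A) :
    tensorμ a b c d ≫ tensorμ a c b d = 𝟙 _ := by
  rw [← tensorμ_tensorδ a b c d]
  simp only [tensorμ, tensorδ, SymmetricCategory.braiding_swap_eq_inv_braiding b c]

/-- The tensor `F □ G`: the composite of `⟨F, G⟩ : A → B × B` and the symmetric monoidal functor
`⊗ : B × B → B`. Hence `(F □ G)(a) = F a ⊗ G a`, `(F □ G)⁰ = (I ≅ I ⊗ I → F I ⊗ G I)`, and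
`(F □ G)²` is the middle-four interchange followed by `F² ⊗ G²`. -/
def box (F G : LaxBraidedFunctor A B) : LaxBraidedFunctor A B where
  toFunctor := Functor.prod' F.toFunctor G.toFunctor ⋙ tensor B
  laxBraided :=
    { (inferInstance : (Functor.prod' F.toFunctor G.toFunctor ⋙ tensor B).LaxMonoidal).copy
        ((λ_ (𝟙_ B)).inv ≫ (ε F.toFunctor ⊗ₘ ε G.toFunctor))
        (fun X Y => tensorμ (F.obj X) (G.obj X) (F.obj Y) (G.obj Y) ≫
          (μ F.toFunctor X Y ⊗ₘ μ G.toFunctor X Y))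
        (by simp [Functor.LaxMonoidal.comp_ε]) (by ext X Y; simp [Functor.LaxMonoidal.comp_μ]) with
      braided := fun X Y => by
        change (tensorμ (F.obj X) (G.obj X) (F.obj Y) (G.obj Y) ≫
          (μ F.toFunctor X Y ⊗ₘ μ G.toFunctor X Y)) ≫
            (F.map (β_ X Y).hom ⊗ₘ G.map (β_ X Y).hom) =
          (β_ (F.obj X ⊗ G.obj X) (F.obj Y ⊗ G.obj Y)).hom ≫
            (tensorμ (F.obj Y) (G.obj Y) (F.obj X) (G.obj X) ≫
              (μ F.toFunctor Y X ⊗ₘ μ G.toFunctor Y X))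
        rw [Category.assoc, tensorHom_comp_tensorHom, Functor.LaxBraided.braided,
          Functor.LaxBraided.braided, ← tensorHom_comp_tensorHom, reassoc_of% tensorμ_braiding] }

/-- The unit of `[A, B]`: the constant functor at the unit `I` of `B`, with `I⁰ = 𝟙` and `I²` the
canonical isomorphism `I ⊗ I ≅ I`. -/
def unitFun (A B : Type u) [SmallCategory A] [MonoidalCategory A] [SymmetricCategory A]
    [SmallCategory B] [MonoidalCategory B] [SymmetricCategory B] : LaxBraidedFunctor A B where
  toFunctor := (Functor.const A).obj (𝟙_ B)
  laxBraided :=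
    { ε := 𝟙 (𝟙_ B)
      μ := fun _ _ => (λ_ (𝟙_ B)).hom
      μ_natural_left := by intros; simp
      μ_natural_right := by intros; simp
      associativity := by intros; simp [unitors_equal]
      left_unitality := by intros; simp
      right_unitality := by intros; simp [unitors_equal]
      braided := fun _ _ => by
        change (λ_ (𝟙_ B)).hom ≫ 𝟙 (𝟙_ B) = (β_ (𝟙_ B) (𝟙_ B)).hom ≫ (λ_ (𝟙_ B)).hom
        rw [Category.comp_id, braiding_leftUnitor, unitors_equal] }

/-- `σ □ τ`, with components `σ_a ⊗ τ_a`. -/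
def boxMap {F G F' G' : LaxBraidedFunctor A B} (σ : F ⟶ G) (τ : F' ⟶ G') : box F F' ⟶ box G G' :=
  mkNat (fun a => napp σ a ⊗ₘ napp τ a)
    (fun a a' f => by
      change (F.map f ⊗ₘ F'.map f) ≫ (napp σ a' ⊗ₘ napp τ a') =
        (napp σ a ⊗ₘ napp τ a) ≫ (G.map f ⊗ₘ G'.map f)
      simp only [tensorHom_comp_tensorHom, napp_naturality])
    (by
      change ((λ_ (𝟙_ B)).inv ≫ (ε F.toFunctor ⊗ₘ ε F'.toFunctor)) ≫
        (napp σ (𝟙_ A) ⊗ₘ napp τ (𝟙_ A)) = (λ_ (𝟙_ B)).inv ≫ (ε G.toFunctor ⊗ₘ ε G'.toFunctor)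
      simp only [Category.assoc, tensorHom_comp_tensorHom, napp_unit])
    (fun a a' => by
      change (tensorμ (F.obj a) (F'.obj a) (F.obj a') (F'.obj a') ≫
          (μ F.toFunctor a a' ⊗ₘ μ F'.toFunctor a a')) ≫
            (napp σ (a ⊗ a') ⊗ₘ napp τ (a ⊗ a')) =
        ((napp σ a ⊗ₘ napp τ a) ⊗ₘ (napp σ a' ⊗ₘ napp τ a')) ≫
          (tensorμ (G.obj a) (G'.obj a) (G.obj a') (G'.obj a') ≫
            (μ G.toFunctor a a' ⊗ₘ μ G'.toFunctor a a'))
      simp only [Category.assoc, tensorHom_comp_tensorHom, napp_tensor, tensorμ_natural_assoc])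

/-- Constructor for monoidal natural isomorphisms. -/
def mkIso {F G : LaxBraidedFunctor A B} (app : ∀ a : A, F.obj a ≅ G.obj a)
    (nat : ∀ ⦃a a' : A⦄ (f : a ⟶ a'), F.map f ≫ (app a').hom = (app a).hom ≫ G.map f)
    (unit : ε F.toFunctor ≫ (app (𝟙_ A)).hom = ε G.toFunctor)
    (tensor : ∀ a a' : A, μ F.toFunctor a a' ≫ (app (a ⊗ a')).hom =
      ((app a).hom ⊗ₘ (app a').hom) ≫ μ G.toFunctor a a') : F ≅ G where
  hom := mkNat (fun a => (app a).hom) nat unit tensor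
  inv := mkNat (fun a => (app a).inv)
    (fun a a' f => by rw [← cancel_epi (app a).hom, ← reassoc_of% nat f]; simp)
    (by rw [← unit]; simp)
    (fun a a' => by
      rw [← cancel_epi ((app a).hom ⊗ₘ (app a').hom), ← reassoc_of% tensor a a',
        tensorHom_comp_tensorHom_assoc]
      simp)
  hom_inv_id := nat_ext fun a => (app a).hom_inv_id
  inv_hom_id := nat_ext fun a => (app a).inv_hom_id

/-- The associativity isomorphism of `[A, B]`, defined pointwise. -/
def boxAssoc (F G H : LaxBraidedFunctor A B) : box (box F G) H ≅ box F (box G H) :=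
  mkIso (fun a => α_ (F.obj a) (G.obj a) (H.obj a))
    (fun a a' f => associator_naturality (F.map f) (G.map f) (H.map f))
    (by
      change ((λ_ (𝟙_ B)).inv ≫ (((λ_ (𝟙_ B)).inv ≫ (ε F.toFunctor ⊗ₘ ε G.toFunctor)) ⊗ₘ
          ε H.toFunctor)) ≫ (α_ (F.obj (𝟙_ A)) (G.obj (𝟙_ A)) (H.obj (𝟙_ A))).hom =
        (λ_ (𝟙_ B)).inv ≫ (ε F.toFunctor ⊗ₘ ((λ_ (𝟙_ B)).inv ≫
          (ε G.toFunctor ⊗ₘ ε H.toFunctor)))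
      have h₁ : ((λ_ (𝟙_ B)).inv ≫ (ε F.toFunctor ⊗ₘ ε G.toFunctor)) ⊗ₘ ε H.toFunctor =
          ((λ_ (𝟙_ B)).inv ▷ 𝟙_ B) ≫ ((ε F.toFunctor ⊗ₘ ε G.toFunctor) ⊗ₘ ε H.toFunctor) := by
        rw [← tensorHom_id, tensorHom_comp_tensorHom, Category.id_comp]
      have h₂ : ε F.toFunctor ⊗ₘ ((λ_ (𝟙_ B)).inv ≫ (ε G.toFunctor ⊗ₘ ε H.toFunctor)) =
          (𝟙_ B ◁ (λ_ (𝟙_ B)).inv) ≫ (ε F.toFunctor ⊗ₘ (ε G.toFunctor ⊗ₘ ε H.toFunctor)) := by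
        rw [← id_tensorHom, tensorHom_comp_tensorHom, Category.id_comp]
      rw [h₁, h₂]
      simp only [Category.assoc, associator_naturality]
      simp only [← Category.assoc]
      congr 1
      monoidal)
    (fun a b => by
      change (tensorμ (F.obj a ⊗ G.obj a) (H.obj a) (F.obj b ⊗ G.obj b) (H.obj b) ≫
          ((tensorμ (F.obj a) (G.obj a) (F.obj b) (G.obj b) ≫
            (μ F.toFunctor a b ⊗ₘ μ G.toFunctor a b)) ⊗ₘ μ H.toFunctor a b)) ≫
          (α_ (F.obj (a ⊗ b)) (G.obj (a ⊗ b)) (H.obj (a ⊗ b))).hom =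
        ((α_ (F.obj a) (G.obj a) (H.obj a)).hom ⊗ₘ (α_ (F.obj b) (G.obj b) (H.obj b)).hom) ≫
          tensorμ (F.obj a) (G.obj a ⊗ H.obj a) (F.obj b) (G.obj b ⊗ H.obj b) ≫
          (μ F.toFunctor a b ⊗ₘ (tensorμ (G.obj a) (H.obj a) (G.obj b) (H.obj b) ≫
            (μ G.toFunctor a b ⊗ₘ μ H.toFunctor a b)))
      have h₁ : (tensorμ (F.obj a) (G.obj a) (F.obj b) (G.obj b) ≫
            (μ F.toFunctor a b ⊗ₘ μ G.toFunctor a b)) ⊗ₘ μ H.toFunctor a b =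
          tensorμ (F.obj a) (G.obj a) (F.obj b) (G.obj b) ▷ (H.obj a ⊗ H.obj b) ≫
            ((μ F.toFunctor a b ⊗ₘ μ G.toFunctor a b) ⊗ₘ μ H.toFunctor a b) := by
        rw [← tensorHom_id, tensorHom_comp_tensorHom, Category.id_comp]
      have h₂ : μ F.toFunctor a b ⊗ₘ (tensorμ (G.obj a) (H.obj a) (G.obj b) (H.obj b) ≫
            (μ G.toFunctor a b ⊗ₘ μ H.toFunctor a b)) =
          (F.obj a ⊗ F.obj b) ◁ tensorμ (G.obj a) (H.obj a) (G.obj b) (H.obj b) ≫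
            (μ F.toFunctor a b ⊗ₘ (μ G.toFunctor a b ⊗ₘ μ H.toFunctor a b)) := by
        rw [← id_tensorHom, tensorHom_comp_tensorHom, Category.id_comp]
      rw [h₁, h₂]
      simp only [Category.assoc, associator_naturality]
      rw [associator_monoidal_assoc])

/-- The left unit isomorphism of `[A, B]`, defined pointwise. -/
def boxLeft (F : LaxBraidedFunctor A B) : box (unitFun A B) F ≅ F :=
  mkIso (fun a => λ_ (F.obj a))
    (fun a a' f => by
      change (𝟙 (𝟙_ B) ⊗ₘ F.map f) ≫ (λ_ (F.obj a')).hom = (λ_ (F.obj a)).hom ≫ F.map f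
      rw [id_tensorHom, leftUnitor_naturality])
    (by
      change ((λ_ (𝟙_ B)).inv ≫ (𝟙 (𝟙_ B) ⊗ₘ ε F.toFunctor)) ≫ (λ_ (F.obj (𝟙_ A))).hom =
        ε F.toFunctor
      rw [id_tensorHom, Category.assoc, leftUnitor_naturality, Iso.inv_hom_id_assoc])
    (fun a b => by
      change (tensorμ (𝟙_ B) (F.obj a) (𝟙_ B) (F.obj b) ≫
          ((λ_ (𝟙_ B)).hom ⊗ₘ μ F.toFunctor a b)) ≫ (λ_ (F.obj (a ⊗ b))).hom =
        ((λ_ (F.obj a)).hom ⊗ₘ (λ_ (F.obj b)).hom) ≫ μ F.toFunctor a b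
      rw [leftUnitor_monoidal, MonoidalCategory.tensorHom_def]
      simp only [Category.assoc, leftUnitor_naturality])

/-- The right unit isomorphism of `[A, B]`, defined pointwise. -/
def boxRight (F : LaxBraidedFunctor A B) : box F (unitFun A B) ≅ F :=
  mkIso (fun a => ρ_ (F.obj a))
    (fun a a' f => by
      change (F.map f ⊗ₘ 𝟙 (𝟙_ B)) ≫ (ρ_ (F.obj a')).hom = (ρ_ (F.obj a)).hom ≫ F.map f
      rw [tensorHom_id, rightUnitor_naturality])
    (by
      change ((λ_ (𝟙_ B)).inv ≫ (ε F.toFunctor ⊗ₘ 𝟙 (𝟙_ B))) ≫ (ρ_ (F.obj (𝟙_ A))).hom =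
        ε F.toFunctor
      rw [tensorHom_id, Category.assoc, rightUnitor_naturality, ← unitors_equal,
        Iso.inv_hom_id_assoc])
    (fun a b => by
      change (tensorμ (F.obj a) (𝟙_ B) (F.obj b) (𝟙_ B) ≫
          (μ F.toFunctor a b ⊗ₘ (λ_ (𝟙_ B)).hom)) ≫ (ρ_ (F.obj (a ⊗ b))).hom =
        ((ρ_ (F.obj a)).hom ⊗ₘ (ρ_ (F.obj b)).hom) ≫ μ F.toFunctor a b
      rw [rightUnitor_monoidal, MonoidalCategory.tensorHom_def']
      simp only [Category.assoc, rightUnitor_naturality])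

/-- The symmetry of `[A, B]`, defined pointwise. -/
def boxSymm (F G : LaxBraidedFunctor A B) : box F G ≅ box G F :=
  mkIso (fun a => β_ (F.obj a) (G.obj a))
    (fun a a' f => BraidedCategory.braiding_naturality (F.map f) (G.map f))
    (by
      change ((λ_ (𝟙_ B)).inv ≫ (ε F.toFunctor ⊗ₘ ε G.toFunctor)) ≫
        (β_ (F.obj (𝟙_ A)) (G.obj (𝟙_ A))).hom =
          (λ_ (𝟙_ B)).inv ≫ (ε G.toFunctor ⊗ₘ ε F.toFunctor)
      rw [Category.assoc, BraidedCategory.braiding_naturality, ← Category.assoc]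
      congr 1
      rw [Iso.inv_comp_eq, Iso.hom_inv_id, ← cancel_mono (λ_ (𝟙_ B)).hom, braiding_leftUnitor,
        Category.id_comp, unitors_equal])
    (fun a b => by
      change (tensorμ (F.obj a) (G.obj a) (F.obj b) (G.obj b) ≫
          (μ F.toFunctor a b ⊗ₘ μ G.toFunctor a b)) ≫
            (β_ (F.obj (a ⊗ b)) (G.obj (a ⊗ b))).hom =
        ((β_ (F.obj a) (G.obj a)).hom ⊗ₘ (β_ (F.obj b) (G.obj b)).hom) ≫
          tensorμ (G.obj a) (F.obj a) (G.obj b) (F.obj b) ≫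
            (μ G.toFunctor a b ⊗ₘ μ F.toFunctor a b)
      rw [Category.assoc, BraidedCategory.braiding_naturality, reassoc_of% tensorμ_braiding'])

/-- The pointwise monoidal structure of `[A, B]`. -/
instance : MonoidalCategory (LaxBraidedFunctor A B) where
  tensorObj := box
  tensorUnit := unitFun A B
  tensorHom := boxMap
  whiskerLeft F _ _ τ := boxMap (𝟙 F) τ
  whiskerRight σ F := boxMap σ (𝟙 F)
  associator := boxAssoc
  leftUnitor := boxLeft
  rightUnitor := boxRight
  tensorHom_def {F G F' G'} σ τ := nat_ext fun a => by
    change napp σ a ⊗ₘ napp τ a = (napp σ a ⊗ₘ 𝟙 (F'.obj a)) ≫ (𝟙 (G.obj a) ⊗ₘ napp τ a)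
    rw [tensorHom_id, id_tensorHom, MonoidalCategory.tensorHom_def]
  id_tensorHom_id F G := nat_ext fun a => id_tensorHom_id (F.obj a) (G.obj a)
  tensorHom_comp_tensorHom σ τ σ' τ' := nat_ext fun a =>
    tensorHom_comp_tensorHom (napp σ a) (napp τ a) (napp σ' a) (napp τ' a)
  whiskerLeft_id F G := nat_ext fun a => id_tensorHom_id (F.obj a) (G.obj a)
  id_whiskerRight F G := nat_ext fun a => id_tensorHom_id (F.obj a) (G.obj a)
  associator_naturality σ τ υ := nat_ext fun a =>
    associator_naturality (napp σ a) (napp τ a) (napp υ a)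
  leftUnitor_naturality {F G} σ := nat_ext fun a => by
    change (𝟙 (𝟙_ B) ⊗ₘ napp σ a) ≫ (λ_ (G.obj a)).hom = (λ_ (F.obj a)).hom ≫ napp σ a
    rw [id_tensorHom, leftUnitor_naturality]
  rightUnitor_naturality {F G} σ := nat_ext fun a => by
    change (napp σ a ⊗ₘ 𝟙 (𝟙_ B)) ≫ (ρ_ (G.obj a)).hom = (ρ_ (F.obj a)).hom ≫ napp σ a
    rw [tensorHom_id, rightUnitor_naturality]
  pentagon F G H K := nat_ext fun a => by
    change ((α_ (F.obj a) (G.obj a) (H.obj a)).hom ⊗ₘ 𝟙 (K.obj a)) ≫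
      (α_ (F.obj a) (G.obj a ⊗ H.obj a) (K.obj a)).hom ≫
        (𝟙 (F.obj a) ⊗ₘ (α_ (G.obj a) (H.obj a) (K.obj a)).hom) =
      (α_ (F.obj a ⊗ G.obj a) (H.obj a) (K.obj a)).hom ≫
        (α_ (F.obj a) (G.obj a) (H.obj a ⊗ K.obj a)).hom
    rw [tensorHom_id, id_tensorHom, pentagon]
  triangle F G := nat_ext fun a => by
    change (α_ (F.obj a) (𝟙_ B) (G.obj a)).hom ≫ (𝟙 (F.obj a) ⊗ₘ (λ_ (G.obj a)).hom) =
      (ρ_ (F.obj a)).hom ⊗ₘ 𝟙 (G.obj a)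
    rw [tensorHom_id, id_tensorHom, triangle]

/-- The pointwise symmetry of `[A, B]`. -/
instance : SymmetricCategory (LaxBraidedFunctor A B) where
  braiding := boxSymm
  braiding_naturality_right F G H σ := nat_ext fun a => by
    change (𝟙 (F.obj a) ⊗ₘ napp σ a) ≫ (β_ (F.obj a) (H.obj a)).hom =
      (β_ (F.obj a) (G.obj a)).hom ≫ (napp σ a ⊗ₘ 𝟙 (F.obj a))
    rw [BraidedCategory.braiding_naturality]
  braiding_naturality_left {F G} σ H := nat_ext fun a => by
    change (napp σ a ⊗ₘ 𝟙 (H.obj a)) ≫ (β_ (G.obj a) (H.obj a)).hom =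
      (β_ (F.obj a) (H.obj a)).hom ≫ (𝟙 (H.obj a) ⊗ₘ napp σ a)
    rw [BraidedCategory.braiding_naturality]
  hexagon_forward F G H := nat_ext fun a => by
    change (α_ (F.obj a) (G.obj a) (H.obj a)).hom ≫ (β_ (F.obj a) (G.obj a ⊗ H.obj a)).hom ≫
        (α_ (G.obj a) (H.obj a) (F.obj a)).hom =
      ((β_ (F.obj a) (G.obj a)).hom ⊗ₘ 𝟙 (H.obj a)) ≫ (α_ (G.obj a) (F.obj a) (H.obj a)).hom ≫
        (𝟙 (G.obj a) ⊗ₘ (β_ (F.obj a) (H.obj a)).hom)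
    rw [tensorHom_id, id_tensorHom, BraidedCategory.hexagon_forward]
  hexagon_reverse F G H := nat_ext fun a => by
    change (α_ (F.obj a) (G.obj a) (H.obj a)).inv ≫ (β_ (F.obj a ⊗ G.obj a) (H.obj a)).hom ≫
        (α_ (H.obj a) (F.obj a) (G.obj a)).inv =
      (𝟙 (F.obj a) ⊗ₘ (β_ (G.obj a) (H.obj a)).hom) ≫ (α_ (F.obj a) (H.obj a) (G.obj a)).inv ≫
        ((β_ (F.obj a) (H.obj a)).hom ⊗ₘ 𝟙 (G.obj a))
    rw [tensorHom_id, id_tensorHom, BraidedCategory.hexagon_reverse]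
  symmetry F G := nat_ext fun a => SymmetricCategory.symmetry (F.obj a) (G.obj a)

/-! ### Symmetric monoidal functors `A → [B, C]`, pointwise -/

section Pointwise

variable (F : LaxBraidedFunctor A (LaxBraidedFunctor B C))

/-- The component `(F⁰)_b : I → F(I)(b)`. -/
def unitAt (b : B) : 𝟙_ C ⟶ (F.obj (𝟙_ A)).obj b := napp (ε F.toFunctor) b

/-- The component `(F²_{a,a'})_b : F(a)(b) ⊗ F(a')(b) → F(a ⊗ a')(b)`. -/
def tensorAt (a a' : A) (b : B) : (F.obj a).obj b ⊗ (F.obj a').obj b ⟶ (F.obj (a ⊗ a')).obj b :=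
  napp (μ F.toFunctor a a') b

/-- The component `F(f)_b : F(a)(b) → F(a')(b)`. -/
def mapAt {a a' : A} (f : a ⟶ a') (b : B) : (F.obj a).obj b ⟶ (F.obj a').obj b :=
  napp (F.map f) b

theorem mapAt_id (a : A) (b : B) : mapAt F (𝟙 a) b = 𝟙 _ := by
  unfold mapAt; rw [F.map_id]; rfl

theorem mapAt_comp {a a' a'' : A} (f : a ⟶ a') (g : a' ⟶ a'') (b : B) :
    mapAt F (f ≫ g) b = mapAt F f b ≫ mapAt F g b := by
  unfold mapAt; rw [F.map_comp]; rfl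

theorem mapAt_naturality {a a' : A} (f : a ⟶ a') {b b' : B} (g : b ⟶ b') :
    (F.obj a).map g ≫ mapAt F f b' = mapAt F f b ≫ (F.obj a').map g :=
  napp_naturality (F.map f) g

theorem mapAt_unit {a a' : A} (f : a ⟶ a') :
    ε (F.obj a).toFunctor ≫ mapAt F f (𝟙_ B) = ε (F.obj a').toFunctor :=
  napp_unit (F.map f)

theorem mapAt_tensor {a a' : A} (f : a ⟶ a') (b b' : B) :
    μ (F.obj a).toFunctor b b' ≫ mapAt F f (b ⊗ b') =
      (mapAt F f b ⊗ₘ mapAt F f b') ≫ μ (F.obj a').toFunctor b b' :=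
  napp_tensor (F.map f) b b'

theorem unitAt_naturality {b b' : B} (g : b ⟶ b') :
    unitAt F b ≫ (F.obj (𝟙_ A)).map g = unitAt F b' := by
  have h : 𝟙 (𝟙_ C) ≫ unitAt F b' = unitAt F b ≫ (F.obj (𝟙_ A)).map g :=
    napp_naturality (ε F.toFunctor) g
  rw [← h, Category.id_comp]

theorem unitAt_unit : unitAt F (𝟙_ B) = ε (F.obj (𝟙_ A)).toFunctor := by
  have h : 𝟙 (𝟙_ C) ≫ unitAt F (𝟙_ B) = ε (F.obj (𝟙_ A)).toFunctor := napp_unit (ε F.toFunctor)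
  rw [← h, Category.id_comp]

theorem unitAt_tensor (b b' : B) :
    (unitAt F b ⊗ₘ unitAt F b') ≫ μ (F.obj (𝟙_ A)).toFunctor b b' =
      (λ_ (𝟙_ C)).hom ≫ unitAt F (b ⊗ b') :=
  (napp_tensor (ε F.toFunctor) b b').symm

theorem tensorAt_naturality (a a' : A) {b b' : B} (g : b ⟶ b') :
    ((F.obj a).map g ⊗ₘ (F.obj a').map g) ≫ tensorAt F a a' b' =
      tensorAt F a a' b ≫ (F.obj (a ⊗ a')).map g :=
  napp_naturality (μ F.toFunctor a a') g

theorem tensorAt_unit (a a' : A) :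
    (ε (F.obj a).toFunctor ⊗ₘ ε (F.obj a').toFunctor) ≫ tensorAt F a a' (𝟙_ B) =
      (λ_ (𝟙_ C)).hom ≫ ε (F.obj (a ⊗ a')).toFunctor := by
  have h : ((λ_ (𝟙_ C)).inv ≫ (ε (F.obj a).toFunctor ⊗ₘ ε (F.obj a').toFunctor)) ≫
      tensorAt F a a' (𝟙_ B) = ε (F.obj (a ⊗ a')).toFunctor := napp_unit (μ F.toFunctor a a')
  rw [← h, Category.assoc, Iso.hom_inv_id_assoc]

theorem tensorAt_tensor (a a' : A) (b b' : B) :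
    tensorμ ((F.obj a).obj b) ((F.obj a').obj b) ((F.obj a).obj b') ((F.obj a').obj b') ≫
      (μ (F.obj a).toFunctor b b' ⊗ₘ μ (F.obj a').toFunctor b b') ≫ tensorAt F a a' (b ⊗ b') =
    (tensorAt F a a' b ⊗ₘ tensorAt F a a' b') ≫ μ (F.obj (a ⊗ a')).toFunctor b b' := by
  rw [← Category.assoc]
  exact napp_tensor (μ F.toFunctor a a') b b'

theorem tensorAt_natural_left {a a' : A} (f : a ⟶ a') (x : A) (b : B) :
    mapAt F f b ▷ (F.obj x).obj b ≫ tensorAt F a' x b =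
      tensorAt F a x b ≫ mapAt F (f ▷ x) b := by
  rw [← tensorHom_id]
  exact congrArg (fun σ => napp σ b) (μ_natural_left F.toFunctor f x)

theorem tensorAt_natural_right (x : A) {a a' : A} (f : a ⟶ a') (b : B) :
    (F.obj x).obj b ◁ mapAt F f b ≫ tensorAt F x a' b =
      tensorAt F x a b ≫ mapAt F (x ◁ f) b := by
  rw [← id_tensorHom]
  exact congrArg (fun σ => napp σ b) (μ_natural_right F.toFunctor x f)

theorem tensorAt_associativity (x y z : A) (b : B) :
    tensorAt F x y b ▷ (F.obj z).obj b ≫ tensorAt F (x ⊗ y) z b ≫ mapAt F (α_ x y z).hom b =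
      (α_ ((F.obj x).obj b) ((F.obj y).obj b) ((F.obj z).obj b)).hom ≫
        (F.obj x).obj b ◁ tensorAt F y z b ≫ tensorAt F x (y ⊗ z) b := by
  rw [← tensorHom_id, ← id_tensorHom]
  exact congrArg (fun σ => napp σ b) (associativity F.toFunctor x y z)

theorem tensorAt_left_unitality (x : A) (b : B) :
    (λ_ ((F.obj x).obj b)).hom =
      unitAt F b ▷ (F.obj x).obj b ≫ tensorAt F (𝟙_ A) x b ≫ mapAt F (λ_ x).hom b := by
  rw [← tensorHom_id]
  exact congrArg (fun σ => napp σ b) (left_unitality F.toFunctor x)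

theorem tensorAt_right_unitality (x : A) (b : B) :
    (ρ_ ((F.obj x).obj b)).hom =
      (F.obj x).obj b ◁ unitAt F b ≫ tensorAt F x (𝟙_ A) b ≫ mapAt F (ρ_ x).hom b := by
  rw [← id_tensorHom]
  exact congrArg (fun σ => napp σ b) (right_unitality F.toFunctor x)

theorem tensorAt_braided (x y : A) (b : B) :
    tensorAt F x y b ≫ mapAt F (β_ x y).hom b =
      (β_ ((F.obj x).obj b) ((F.obj y).obj b)).hom ≫ tensorAt F y x b :=
  congrArg (fun σ => napp σ b) (Functor.LaxBraided.braided (F := F.toFunctor) x y)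

end Pointwise

/-! ### The duality `D`

For `F : A → [B, C]`, the dual `F^* : B → [A, C]` is the symmetric monoidal functor obtained by
exchanging the two arguments. -/

/-- The functor `F^*(b) : A → C`, `a ↦ F(a)(b)`, with `(F^* b)⁰ = (F⁰)_b` and
`(F^* b)²_{a,a'} = (F²_{a,a'})_b`. -/
def dualObj (F : LaxBraidedFunctor A (LaxBraidedFunctor B C)) (b : B) : LaxBraidedFunctor A C where
  toFunctor :=
    { obj := fun a => (F.obj a).obj b
      map := fun f => mapAt F f b
      map_id := fun a => mapAt_id F a b
      map_comp := fun f g => mapAt_comp F f g b }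
  laxBraided :=
    { ε := unitAt F b
      μ := fun a a' => tensorAt F a a' b
      μ_natural_left := fun f x => tensorAt_natural_left F f x b
      μ_natural_right := fun x f => tensorAt_natural_right F x f b
      associativity := fun x y z => tensorAt_associativity F x y z b
      left_unitality := fun x => tensorAt_left_unitality F x b
      right_unitality := fun x => tensorAt_right_unitality F x b
      braided := fun x y => tensorAt_braided F x y b }

/-- The transformation `F^*(g) : F^*(b) → F^*(b')`, with components `F(a)(g)`. -/
def dualMap (F : LaxBraidedFunctor A (LaxBraidedFunctor B C)) {b b' : B} (g : b ⟶ b') :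
    dualObj F b ⟶ dualObj F b' :=
  mkNat (fun a => (F.obj a).map g)
    (fun _ _ f => (mapAt_naturality F f g).symm)
    (unitAt_naturality F g)
    (fun a a' => (tensorAt_naturality F a a' g).symm)

/-- The transformation `(F^*)⁰ : I → F^*(I)`, with components `(F a)⁰`. -/
def dualUnit (F : LaxBraidedFunctor A (LaxBraidedFunctor B C)) :
    unitFun A C ⟶ dualObj F (𝟙_ B) :=
  mkNat (fun a => ε (F.obj a).toFunctor)
    (fun a a' f => by
      change 𝟙 (𝟙_ C) ≫ ε (F.obj a').toFunctor = ε (F.obj a).toFunctor ≫ mapAt F f (𝟙_ B)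
      rw [mapAt_unit, Category.id_comp])
    (by
      change 𝟙 (𝟙_ C) ≫ ε (F.obj (𝟙_ A)).toFunctor = unitAt F (𝟙_ B)
      rw [unitAt_unit, Category.id_comp])
    (fun a a' => (tensorAt_unit F a a').symm)

/-- The transformation `(F^*)²_{b,b'} : F^* b □ F^* b' → F^*(b ⊗ b')`, with components
`(F a)²_{b,b'}`. -/
def dualTensor (F : LaxBraidedFunctor A (LaxBraidedFunctor B C)) (b b' : B) :
    box (dualObj F b) (dualObj F b') ⟶ dualObj F (b ⊗ b') :=
  mkNat (fun a => μ (F.obj a).toFunctor b b')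
    (fun _ _ f => (mapAt_tensor F f b b').symm)
    (by
      change ((λ_ (𝟙_ C)).inv ≫ (unitAt F b ⊗ₘ unitAt F b')) ≫ μ (F.obj (𝟙_ A)).toFunctor b b' =
        unitAt F (b ⊗ b')
      rw [Category.assoc, unitAt_tensor, Iso.inv_hom_id_assoc])
    (fun a a' => by
      change (tensorμ ((F.obj a).obj b) ((F.obj a).obj b') ((F.obj a').obj b)
            ((F.obj a').obj b') ≫ (tensorAt F a a' b ⊗ₘ tensorAt F a a' b')) ≫
          μ (F.obj (a ⊗ a')).toFunctor b b' =
        (μ (F.obj a).toFunctor b b' ⊗ₘ μ (F.obj a').toFunctor b b') ≫ tensorAt F a a' (b ⊗ b')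
      rw [Category.assoc, ← tensorAt_tensor, reassoc_of% tensorμ_tensorμ])

/-- The dual `F^* : B → [A, C]` of `F : A → [B, C]`. -/
def dual (F : LaxBraidedFunctor A (LaxBraidedFunctor B C)) :
    LaxBraidedFunctor B (LaxBraidedFunctor A C) where
  toFunctor :=
    { obj := dualObj F
      map := dualMap F
      map_id := fun b => nat_ext fun a => (F.obj a).map_id b
      map_comp := fun g h => nat_ext fun a => (F.obj a).map_comp g h }
  laxBraided :=
    { ε := dualUnit F
      μ := dualTensor F
      μ_natural_left := fun {b b'} f x => nat_ext fun a => by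
        have h := μ_natural_left (F.obj a).toFunctor f x
        rw [← tensorHom_id] at h
        exact h
      μ_natural_right := fun {b b'} x f => nat_ext fun a => by
        have h := μ_natural_right (F.obj a).toFunctor x f
        rw [← id_tensorHom] at h
        exact h
      associativity := fun x y z => nat_ext fun a => by
        have h := associativity (F.obj a).toFunctor x y z
        rw [← id_tensorHom, ← tensorHom_id] at h
        exact h
      left_unitality := fun x => nat_ext fun a => by
        have h := left_unitality (F.obj a).toFunctor x
        rw [← tensorHom_id] at h
        exact h
      right_unitality := fun x => nat_ext fun a => by
        have h := right_unitality (F.obj a).toFunctor x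
        rw [← id_tensorHom] at h
        exact h
      braided := fun x y => nat_ext fun a =>
        Functor.LaxBraided.braided (F := (F.obj a).toFunctor) x y }

end Hom

/-! ### The tensor `A ⊗ B`, by generators and relations -/

section Tensor

/-- The objects of `A ⊗ B`: words freely built from a unit `I`, the pairs `a ⊗ b` and a binary
operation `⊗`. -/
inductive Tens (A B : Type u) : Type u
  | unit : Tens A B
  | of (a : A) (b : B) : Tens A B
  | tensor (X Y : Tens A B) : Tens A B

variable (A B : Type u) [SmallCategory A] [MonoidalCategory A] [SymmetricCategory A]
  [SmallCategory B] [MonoidalCategory B] [SymmetricCategory B]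

/-- Formal arrows of `A ⊗ B`: formal composites of the generating arrows, which are the canonical
arrows, the arrows `α_b`, `β_a`, `γ_{a,a',b}`, `δ_{a,b,b'}`, the arrows `f ⊗ b` and `a ⊗ g`, and
their expansions by `X ⊗ -` and `- ⊗ X`. -/
inductive FHom : Tens A B → Tens A B → Type u
  | id (X) : FHom X X
  | comp {X Y Z} (p : FHom X Y) (q : FHom Y Z) : FHom X Z
  | whiskerLeft (X) {Y Z} (p : FHom Y Z) : FHom (.tensor X Y) (.tensor X Z)
  | whiskerRight {Y Z} (p : FHom Y Z) (X) : FHom (.tensor Y X) (.tensor Z X)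
  | assoc (X Y Z) : FHom (.tensor (.tensor X Y) Z) (.tensor X (.tensor Y Z))
  | assocInv (X Y Z) : FHom (.tensor X (.tensor Y Z)) (.tensor (.tensor X Y) Z)
  | left (X) : FHom (.tensor .unit X) X
  | leftInv (X) : FHom X (.tensor .unit X)
  | right (X) : FHom (.tensor X .unit) X
  | rightInv (X) : FHom X (.tensor X .unit)
  | symm (X Y) : FHom (.tensor X Y) (.tensor Y X)
  | alpha (b : B) : FHom .unit (.of (𝟙_ A) b)
  | beta (a : A) : FHom .unit (.of a (𝟙_ B))
  | gamma (a a' : A) (b : B) : FHom (.tensor (.of a b) (.of a' b)) (.of (a ⊗ a') b)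
  | delta (a : A) (b b' : B) : FHom (.tensor (.of a b) (.of a b')) (.of a (b ⊗ b'))
  | mapLeft {a a' : A} (f : a ⟶ a') (b : B) : FHom (.of a b) (.of a' b)
  | mapRight (a : A) {b b' : B} (g : b ⟶ b') : FHom (.of a b) (.of a b')

variable {A B}

/-- `p ⊗ q`, as the composite of `p ⊗ X'` and `Y ⊗ q`. -/
def FHom.tens {X Y X' Y' : Tens A B} (p : FHom A B X Y) (q : FHom A B X' Y') :
    FHom A B (.tensor X X') (.tensor Y Y') :=
  .comp (.whiskerRight p X') (.whiskerLeft Y q)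

/-- The canonical arrow `(X ⊗ Y) ⊗ (Z ⊗ W) → (X ⊗ Z) ⊗ (Y ⊗ W)`. -/
def FHom.middle (X Y Z W : Tens A B) :
    FHom A B (.tensor (.tensor X Y) (.tensor Z W)) (.tensor (.tensor X Z) (.tensor Y W)) :=
  .comp (.assoc X Y (.tensor Z W)) <|
  .comp (.whiskerLeft X (.assocInv Y Z W)) <|
  .comp (.whiskerLeft X (.whiskerRight (.symm Y Z) W)) <|
  .comp (.whiskerLeft X (.assoc Z Y W)) <|
  .assocInv X Z (.tensor Y W)

open FHom in
/-- The congruence defining `A ⊗ B`. -/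
inductive FRel : ∀ {X Y : Tens A B}, FHom A B X Y → FHom A B X Y → Prop
  -- equivalence relation, compatible with composition and with `X ⊗ -`, `- ⊗ X`
  | refl {X Y} (p : FHom A B X Y) : FRel p p
  | symm' {X Y} {p q : FHom A B X Y} : FRel p q → FRel q p
  | trans {X Y} {p q r : FHom A B X Y} : FRel p q → FRel q r → FRel p r
  | comp_congr {X Y Z} {p p' : FHom A B X Y} {q q' : FHom A B Y Z} :
      FRel p p' → FRel q q' → FRel (p.comp q) (p'.comp q')
  | whiskerLeft_congr (X) {Y Z} {p p' : FHom A B Y Z} :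
      FRel p p' → FRel (p.whiskerLeft X) (p'.whiskerLeft X)
  | whiskerRight_congr {Y Z} {p p' : FHom A B Y Z} (X) :
      FRel p p' → FRel (p.whiskerRight X) (p'.whiskerRight X)
  -- the category of formal composites, on which `X ⊗ -` and `- ⊗ X` are functors
  | id_comp {X Y} (p : FHom A B X Y) : FRel ((FHom.id X).comp p) p
  | comp_id {X Y} (p : FHom A B X Y) : FRel (p.comp (FHom.id Y)) p
  | comp_assoc {X Y Z W} (p : FHom A B X Y) (q : FHom A B Y Z) (r : FHom A B Z W) :
      FRel ((p.comp q).comp r) (p.comp (q.comp r))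
  | whiskerLeft_id (X Y) : FRel ((FHom.id Y).whiskerLeft X) (FHom.id (.tensor X Y))
  | whiskerLeft_comp (X) {Y Z W} (p : FHom A B Y Z) (q : FHom A B Z W) :
      FRel ((p.comp q).whiskerLeft X) ((p.whiskerLeft X).comp (q.whiskerLeft X))
  | id_whiskerRight (X Y) : FRel ((FHom.id X).whiskerRight Y) (FHom.id (.tensor X Y))
  | comp_whiskerRight {X Y Z} (p : FHom A B X Y) (q : FHom A B Y Z) (W) :
      FRel ((p.comp q).whiskerRight W) ((p.whiskerRight W).comp (q.whiskerRight W))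
  -- bifunctoriality of `⊗`
  | exchange {X Y Z W} (t : FHom A B X Y) (s : FHom A B Z W) :
      FRel ((whiskerLeft X s).comp (whiskerRight t W))
        ((whiskerRight t Z).comp (whiskerLeft Y s))
  -- the canonical arrows are isomorphisms
  | assoc_assocInv (X Y Z) : FRel ((assoc X Y Z).comp (assocInv X Y Z)) (FHom.id _)
  | assocInv_assoc (X Y Z) : FRel ((assocInv X Y Z).comp (assoc X Y Z)) (FHom.id _)
  | left_leftInv (X) : FRel ((left X).comp (leftInv X)) (FHom.id _)
  | leftInv_left (X) : FRel ((leftInv X).comp (left X)) (FHom.id _)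
  | right_rightInv (X) : FRel ((right X).comp (rightInv X)) (FHom.id _)
  | rightInv_right (X) : FRel ((rightInv X).comp (right X)) (FHom.id _)
  | symm_symm (X Y) : FRel ((symm X Y).comp (symm Y X)) (FHom.id _)
  -- the coherence conditions
  | pentagon (X Y Z W) :
      FRel ((whiskerRight (assoc X Y Z) W).comp
          ((assoc X (.tensor Y Z) W).comp (whiskerLeft X (assoc Y Z W))))
        ((assoc (.tensor X Y) Z W).comp (assoc X Y (.tensor Z W)))
  | triangle (X Y) :
      FRel ((assoc X .unit Y).comp (whiskerLeft X (left Y))) (whiskerRight (right X) Y)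
  | symm_left (X) : FRel ((symm X .unit).comp (left X)) (right X)
  | hexagon (X Y Z) :
      FRel ((assocInv X Y Z).comp ((symm (.tensor X Y) Z).comp (assocInv Z X Y)))
        ((whiskerLeft X (symm Y Z)).comp ((assocInv X Z Y).comp (whiskerRight (symm X Z) Y)))
  -- the naturality of the canonical arrows
  | assoc_natural_left {X X'} (p : FHom A B X X') (Y Z) :
      FRel ((whiskerRight (whiskerRight p Y) Z).comp (assoc X' Y Z))
        ((assoc X Y Z).comp (whiskerRight p (.tensor Y Z)))
  | assoc_natural_middle (X) {Y Y'} (p : FHom A B Y Y') (Z) :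
      FRel ((whiskerRight (whiskerLeft X p) Z).comp (assoc X Y' Z))
        ((assoc X Y Z).comp (whiskerLeft X (whiskerRight p Z)))
  | assoc_natural_right (X Y) {Z Z'} (p : FHom A B Z Z') :
      FRel ((whiskerLeft (.tensor X Y) p).comp (assoc X Y Z'))
        ((assoc X Y Z).comp (whiskerLeft X (whiskerLeft Y p)))
  | left_natural {X Y} (p : FHom A B X Y) :
      FRel ((whiskerLeft .unit p).comp (left Y)) ((left X).comp p)
  | right_natural {X Y} (p : FHom A B X Y) :
      FRel ((whiskerRight p .unit).comp (right Y)) ((right X).comp p)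
  | symm_natural_left {X X'} (p : FHom A B X X') (Y) :
      FRel ((whiskerRight p Y).comp (symm X' Y)) ((symm X Y).comp (whiskerLeft Y p))
  | symm_natural_right (X) {Y Y'} (p : FHom A B Y Y') :
      FRel ((whiskerLeft X p).comp (symm X Y')) ((symm X Y).comp (whiskerRight p X))
  -- functoriality of `a ⊗ -` and `- ⊗ b`
  | mapRight_comp (a : A) {b b' b'' : B} (f : b ⟶ b') (g : b' ⟶ b'') :
      FRel (mapRight a (f ≫ g)) ((mapRight a f).comp (mapRight a g))
  | mapLeft_comp {a a' a'' : A} (f : a ⟶ a') (g : a' ⟶ a'') (b : B) :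
      FRel (mapLeft (f ≫ g) b) ((mapLeft f b).comp (mapLeft g b))
  | mapRight_id (a : A) (b : B) : FRel (mapRight a (𝟙 b)) (FHom.id (.of a b))
  | mapLeft_id (a : A) (b : B) : FRel (mapLeft (𝟙 a) b) (FHom.id (.of a b))
  | map_exchange {a a' : A} (f : a ⟶ a') {b b' : B} (g : b ⟶ b') :
      FRel ((mapLeft f b).comp (mapRight a' g)) ((mapRight a g).comp (mapLeft f b'))
  -- the naturality of `α`, `β`, `γ`, `δ`
  | alpha_natural {b b' : B} (g : b ⟶ b') :
      FRel ((alpha b).comp (mapRight (𝟙_ A) g)) (alpha b')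
  | beta_natural {a a' : A} (f : a ⟶ a') :
      FRel ((beta a).comp (mapLeft f (𝟙_ B))) (beta a')
  | gamma_natural_left {a₁ a₂ : A} (f : a₁ ⟶ a₂) (a : A) (b : B) :
      FRel ((whiskerRight (mapLeft f b) (.of a b)).comp (gamma a₂ a b))
        ((gamma a₁ a b).comp (mapLeft (f ▷ a) b))
  | gamma_natural_middle (a : A) {a₁ a₂ : A} (f : a₁ ⟶ a₂) (b : B) :
      FRel ((whiskerLeft (.of a b) (mapLeft f b)).comp (gamma a a₂ b))
        ((gamma a a₁ b).comp (mapLeft (a ◁ f) b))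
  | gamma_natural_right (a a' : A) {b b' : B} (g : b ⟶ b') :
      FRel ((tens (mapRight a g) (mapRight a' g)).comp (gamma a a' b'))
        ((gamma a a' b).comp (mapRight (a ⊗ a') g))
  | delta_natural_left {a a' : A} (f : a ⟶ a') (b b' : B) :
      FRel ((tens (mapLeft f b) (mapLeft f b')).comp (delta a' b b'))
        ((delta a b b').comp (mapLeft f (b ⊗ b')))
  | delta_natural_middle (a : A) {b₁ b₂ : B} (g : b₁ ⟶ b₂) (b : B) :
      FRel ((whiskerRight (mapRight a g) (.of a b)).comp (delta a b₂ b))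
        ((delta a b₁ b).comp (mapRight a (g ▷ b)))
  | delta_natural_right (a : A) (b : B) {b₁ b₂ : B} (g : b₁ ⟶ b₂) :
      FRel ((whiskerLeft (.of a b) (mapRight a g)).comp (delta a b b₂))
        ((delta a b b₁).comp (mapRight a (b ◁ g)))
  -- compatibility of `δ` and `β` with the canonical arrows of `B`
  | delta_assoc (a : A) (b b' b'' : B) :
      FRel ((whiskerRight (delta a b b') (.of a b'')).comp
          ((delta a (b ⊗ b') b'').comp (mapRight a (α_ b b' b'').hom)))
        ((assoc (.of a b) (.of a b') (.of a b'')).comp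
          ((whiskerLeft (.of a b) (delta a b' b'')).comp (delta a b (b' ⊗ b''))))
  | delta_right (a : A) (b : B) :
      FRel (right (.of a b))
        ((whiskerLeft (.of a b) (beta a)).comp
          ((delta a b (𝟙_ B)).comp (mapRight a (ρ_ b).hom)))
  | delta_left (a : A) (b : B) :
      FRel (left (.of a b))
        ((whiskerRight (beta a) (.of a b)).comp
          ((delta a (𝟙_ B) b).comp (mapRight a (λ_ b).hom)))
  | delta_symm (a : A) (b b' : B) :
      FRel ((delta a b b').comp (mapRight a (β_ b b').hom))
        ((symm (.of a b) (.of a b')).comp (delta a b' b))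
  -- compatibility of `γ` and `α` with the canonical arrows of `A`
  | gamma_assoc (a a' a'' : A) (b : B) :
      FRel ((whiskerRight (gamma a a' b) (.of a'' b)).comp
          ((gamma (a ⊗ a') a'' b).comp (mapLeft (α_ a a' a'').hom b)))
        ((assoc (.of a b) (.of a' b) (.of a'' b)).comp
          ((whiskerLeft (.of a b) (gamma a' a'' b)).comp (gamma a (a' ⊗ a'') b)))
  | gamma_right (a : A) (b : B) :
      FRel (right (.of a b))
        ((whiskerLeft (.of a b) (alpha b)).comp
          ((gamma a (𝟙_ A) b).comp (mapLeft (ρ_ a).hom b)))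
  | gamma_left (a : A) (b : B) :
      FRel (left (.of a b))
        ((whiskerRight (alpha b) (.of a b)).comp
          ((gamma (𝟙_ A) a b).comp (mapLeft (λ_ a).hom b)))
  | gamma_symm (a a' : A) (b : B) :
      FRel ((gamma a a' b).comp (mapLeft (β_ a a').hom b))
        ((symm (.of a b) (.of a' b)).comp (gamma a' a b))
  -- compatibility of `α`, `β`, `γ` and `δ` with one another
  | alpha_delta (b b' : B) :
      FRel ((tens (alpha b) (alpha b')).comp (delta (𝟙_ A) b b'))
        ((left .unit).comp (alpha (b ⊗ b')))
  | beta_gamma (a a' : A) :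
      FRel ((tens (beta a) (beta a')).comp (gamma a a' (𝟙_ B)))
        ((left .unit).comp (beta (a ⊗ a')))
  | beta_alpha : FRel (beta (𝟙_ A)) (alpha (𝟙_ B))
  | delta_gamma (a a' : A) (b b' : B) :
      FRel ((tens (delta a b b') (delta a' b b')).comp (gamma a a' (b ⊗ b')))
        ((middle (.of a b) (.of a b') (.of a' b) (.of a' b')).comp
          ((tens (gamma a a' b) (gamma a a' b')).comp (delta (a ⊗ a') b b')))

/-- Equivalence of formal arrows. -/
instance FHom.setoid (X Y : Tens A B) : Setoid (FHom A B X Y) :=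
  ⟨FRel, ⟨FRel.refl, FRel.symm', FRel.trans⟩⟩

instance : SmallCategory (Tens A B) where
  Hom X Y := Quotient (FHom.setoid X Y)
  id X := ⟦FHom.id X⟧
  comp := Quotient.map₂ FHom.comp (fun _ _ hp _ _ hq => FRel.comp_congr hp hq)
  id_comp := by rintro X Y ⟨p⟩; exact Quotient.sound (FRel.id_comp p)
  comp_id := by rintro X Y ⟨p⟩; exact Quotient.sound (FRel.comp_id p)
  assoc := by rintro X Y Z W ⟨p⟩ ⟨q⟩ ⟨r⟩; exact Quotient.sound (FRel.comp_assoc p q r)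

/-- The arrow of `A ⊗ B` represented by a formal arrow. -/
def FHom.mk {X Y : Tens A B} (p : FHom A B X Y) : X ⟶ Y := Quotient.mk (FHom.setoid X Y) p

theorem FHom.sound {X Y : Tens A B} {p q : FHom A B X Y} (h : FRel p q) : p.mk = q.mk :=
  Quotient.sound h

theorem FHom.mk_surj {X Y : Tens A B} (f : X ⟶ Y) : ∃ p : FHom A B X Y, p.mk = f :=
  Quotient.exists_rep f

instance : MonoidalCategoryStruct (Tens A B) where
  tensorObj := Tens.tensor
  tensorUnit := Tens.unit
  whiskerLeft X _ _ := Quotient.map (FHom.whiskerLeft X) (fun _ _ h => FRel.whiskerLeft_congr X h)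
  whiskerRight f X := Quotient.map (fun p => FHom.whiskerRight p X)
    (fun _ _ h => FRel.whiskerRight_congr X h) f
  associator X Y Z := ⟨(FHom.assoc X Y Z).mk, (FHom.assocInv X Y Z).mk,
    FHom.sound (FRel.assoc_assocInv X Y Z), FHom.sound (FRel.assocInv_assoc X Y Z)⟩
  leftUnitor X := ⟨(FHom.left X).mk, (FHom.leftInv X).mk,
    FHom.sound (FRel.left_leftInv X), FHom.sound (FRel.leftInv_left X)⟩
  rightUnitor X := ⟨(FHom.right X).mk, (FHom.rightInv X).mk,
    FHom.sound (FRel.right_rightInv X), FHom.sound (FRel.rightInv_right X)⟩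

instance : MonoidalCategory (Tens A B) where
  whiskerLeft_id X Y := FHom.sound (FRel.whiskerLeft_id X Y)
  id_whiskerRight X Y := FHom.sound (FRel.id_whiskerRight X Y)
  id_tensorHom_id X Y := FHom.sound
    ((FRel.comp_congr (FRel.id_whiskerRight X Y) (FRel.whiskerLeft_id X Y)).trans (FRel.id_comp _))
  tensorHom_comp_tensorHom := by
    rintro X₁ Y₁ Z₁ X₂ Y₂ Z₂ ⟨f₁⟩ ⟨f₂⟩ ⟨g₁⟩ ⟨g₂⟩
    refine FHom.sound (p := (f₁.tens f₂).comp (g₁.tens g₂))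
      (q := (f₁.comp g₁).tens (f₂.comp g₂)) ?_
    refine (FRel.comp_assoc _ _ _).trans ?_
    refine .trans ?_ (FRel.comp_congr (FRel.comp_whiskerRight _ _ _)
      (FRel.whiskerLeft_comp _ _ _)).symm'
    refine .trans ?_ (FRel.comp_assoc _ _ _).symm'
    refine FRel.comp_congr (.refl _) ?_
    refine (FRel.comp_assoc _ _ _).symm'.trans ?_
    refine .trans ?_ (FRel.comp_assoc _ _ _)
    exact FRel.comp_congr (FRel.exchange _ _) (.refl _)
  associator_naturality := by
    rintro X₁ X₂ X₃ Y₁ Y₂ Y₃ ⟨f₁⟩ ⟨f₂⟩ ⟨f₃⟩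
    refine FHom.sound (p := ((f₁.tens f₂).tens f₃).comp (.assoc Y₁ Y₂ Y₃))
      (q := (FHom.assoc X₁ X₂ X₃).comp (f₁.tens (f₂.tens f₃))) ?_
    refine (FRel.comp_assoc _ _ _).trans ?_
    refine (FRel.comp_congr (.refl _) (FRel.assoc_natural_right _ _ _)).trans ?_
    refine (FRel.comp_assoc _ _ _).symm'.trans ?_
    refine (FRel.comp_congr (FRel.comp_congr (FRel.comp_whiskerRight _ _ _) (.refl _))
      (.refl _)).trans ?_
    refine (FRel.comp_congr (FRel.comp_assoc _ _ _) (.refl _)).trans ?_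
    refine (FRel.comp_congr (FRel.comp_congr (.refl _) (FRel.assoc_natural_middle _ _ _))
      (.refl _)).trans ?_
    refine (FRel.comp_congr (FRel.comp_assoc _ _ _).symm' (.refl _)).trans ?_
    refine (FRel.comp_congr (FRel.comp_congr (FRel.assoc_natural_left _ _ _) (.refl _))
      (.refl _)).trans ?_
    refine (FRel.comp_congr (FRel.comp_assoc _ _ _) (.refl _)).trans ?_
    refine (FRel.comp_assoc _ _ _).trans ?_
    refine FRel.comp_congr (.refl _) ?_
    refine (FRel.comp_assoc _ _ _).trans ?_
    exact FRel.comp_congr (.refl _) (FRel.whiskerLeft_comp _ _ _).symm'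
  leftUnitor_naturality := by
    rintro X Y ⟨p⟩
    exact FHom.sound (FRel.left_natural p)
  rightUnitor_naturality := by
    rintro X Y ⟨p⟩
    exact FHom.sound (FRel.right_natural p)
  pentagon X Y Z W := FHom.sound (FRel.pentagon X Y Z W)
  triangle X Y := FHom.sound (FRel.triangle X Y)

/-- The symmetry of `A ⊗ B`. -/
def Tens.braidingIso (X Y : Tens A B) : X ⊗ Y ≅ Y ⊗ X :=
  ⟨(FHom.symm X Y).mk, (FHom.symm Y X).mk,
    FHom.sound (FRel.symm_symm X Y), FHom.sound (FRel.symm_symm Y X)⟩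

theorem Tens.hexagon (X Y Z : Tens A B) :
    (α_ X Y Z).inv ≫ (Tens.braidingIso (X ⊗ Y) Z).hom ≫ (α_ Z X Y).inv =
      X ◁ (Tens.braidingIso Y Z).hom ≫ (α_ X Z Y).inv ≫ (Tens.braidingIso X Z).hom ▷ Y :=
  FHom.sound (FRel.hexagon X Y Z)

instance : SymmetricCategory (Tens A B) where
  braiding := Tens.braidingIso
  braiding_naturality_right := by
    rintro X Y Z ⟨p⟩
    exact FHom.sound (FRel.symm_natural_right X p)
  braiding_naturality_left := by
    rintro X Y ⟨p⟩ Z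
    exact FHom.sound (FRel.symm_natural_left p Z)
  hexagon_reverse := Tens.hexagon
  hexagon_forward X Y Z := by
    have h : (α_ X Y Z).hom ≫ (Tens.braidingIso (Y ⊗ Z) X).inv ≫ (α_ Y Z X).hom =
        (Tens.braidingIso Y X).inv ▷ Z ≫ (α_ Y X Z).hom ≫ Y ◁ (Tens.braidingIso Z X).inv := by
      have := congrArg (fun f => f) (Tens.hexagon Y Z X)
      rw [← cancel_epi ((Tens.braidingIso Y X).hom ▷ Z), ← cancel_epi (α_ Y X Z).inv,
        ← cancel_epi (Y ◁ (Tens.braidingIso Z X).hom)]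
      have h2 := congrArg (fun f => f ≫ (α_ X Y Z).hom ≫ (Tens.braidingIso (Y ⊗ Z) X).inv ≫
        (α_ Y Z X).hom) (Tens.hexagon Y Z X)
      simp only [Category.assoc] at h2
      rw [← h2]
      simp [← MonoidalCategory.whiskerLeft_comp, ← comp_whiskerRight_assoc]
    exact h
  symmetry X Y := (Tens.braidingIso X Y).hom_inv_id

/-! ### The universal symmetric monoidal functor `η : A → [B, A ⊗ B]` -/

/-- The generator `a ⊗ b`. -/
def pureT (a : A) (b : B) : Tens A B := .of a b

/-- The arrow `tens` of formal arrows represents the tensor of arrows. -/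
theorem FHom.mk_tens {X Y X' Y' : Tens A B} (p : FHom A B X Y) (q : FHom A B X' Y') :
    (p.tens q).mk = p.mk ⊗ₘ q.mk := rfl

theorem FHom.mk_middle (X Y Z W : Tens A B) : (FHom.middle X Y Z W).mk = tensorμ X Y Z W := rfl

variable {C : Type u} [SmallCategory C] [MonoidalCategory C] [SymmetricCategory C]
variable (A B) in
/-- The symmetric monoidal functor `η(a) : B → A ⊗ B`, `b ↦ a ⊗ b`, `g ↦ a ⊗ g`, with
`η(a)⁰ = β_a` and `η(a)²_{b,b'} = δ_{a,b,b'}`. -/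
def etaObj (a : A) : LaxBraidedFunctor B (Tens A B) where
  toFunctor :=
    { obj := fun b => .of a b
      map := fun g => (FHom.mapRight a g).mk
      map_id := fun b => FHom.sound (FRel.mapRight_id a b)
      map_comp := fun f g => FHom.sound (FRel.mapRight_comp a f g) }
  laxBraided :=
    { ε := (FHom.beta a).mk
      μ := fun b b' => (FHom.delta a b b').mk
      μ_natural_left := fun g b => FHom.sound (FRel.delta_natural_middle a g b)
      μ_natural_right := fun b g => FHom.sound (FRel.delta_natural_right a b g)
      associativity := fun b b' b'' => FHom.sound (FRel.delta_assoc a b b' b'')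
      left_unitality := fun b => FHom.sound (FRel.delta_left a b)
      right_unitality := fun b => FHom.sound (FRel.delta_right a b)
      braided := fun b b' => FHom.sound (FRel.delta_symm a b b') }

variable (B) in
/-- The transformation `η(f) : η(a) → η(a')`, with components `f ⊗ b`. -/
def etaMap {a a' : A} (f : a ⟶ a') : etaObj A B a ⟶ etaObj A B a' :=
  mkNat (fun b => (FHom.mapLeft f b).mk)
    (fun _ _ g => (FHom.sound (FRel.map_exchange f g)).symm)
    (FHom.sound (FRel.beta_natural f))
    (fun b b' => (FHom.sound (FRel.delta_natural_left f b b')).symm)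

variable (A B) in
/-- The transformation `η⁰ : I → η(I)`, with components `α_b`. -/
def etaUnit : unitFun B (Tens A B) ⟶ etaObj A B (𝟙_ A) :=
  mkNat (fun b => (FHom.alpha b).mk)
    (fun b b' g => by
      change 𝟙 (𝟙_ (Tens A B)) ≫ (FHom.alpha b').mk = (FHom.alpha b).mk ≫ (FHom.mapRight _ g).mk
      rw [Category.id_comp]
      exact (FHom.sound (FRel.alpha_natural g)).symm)
    (by
      change 𝟙 (𝟙_ (Tens A B)) ≫ (FHom.alpha (𝟙_ B)).mk = (FHom.beta (𝟙_ A)).mk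
      rw [Category.id_comp]
      exact (FHom.sound FRel.beta_alpha).symm)
    (fun b b' => (FHom.sound (FRel.alpha_delta b b')).symm)

variable (B) in
/-- The transformation `η²_{a,a'} : η(a) □ η(a') → η(a ⊗ a')`, with components
`γ_{a,a',b}`. -/
def etaTensor (a a' : A) : box (etaObj A B a) (etaObj A B a') ⟶ etaObj A B (a ⊗ a') :=
  mkNat (fun b => (FHom.gamma a a' b).mk)
    (fun _ _ g => FHom.sound (FRel.gamma_natural_right a a' g))
    (by
      change ((λ_ (𝟙_ (Tens A B))).inv ≫ ((FHom.beta a).mk ⊗ₘ (FHom.beta a').mk)) ≫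
        (FHom.gamma a a' (𝟙_ B)).mk = (FHom.beta (a ⊗ a')).mk
      rw [Category.assoc, Iso.inv_comp_eq]
      exact FHom.sound (FRel.beta_gamma a a'))
    (fun b b' => by
      have h : ((FHom.delta a b b').mk ⊗ₘ (FHom.delta a' b b').mk) ≫
          (FHom.gamma a a' (b ⊗ b')).mk =
          tensorμ (Tens.of a b) (Tens.of a b') (Tens.of a' b) (Tens.of a' b') ≫
            ((FHom.gamma a a' b).mk ⊗ₘ (FHom.gamma a a' b').mk) ≫
              (FHom.delta (a ⊗ a') b b').mk := FHom.sound (FRel.delta_gamma a a' b b')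
      change (tensorμ (Tens.of a b) (Tens.of a' b) (Tens.of a b') (Tens.of a' b') ≫
        ((FHom.delta a b b').mk ⊗ₘ (FHom.delta a' b b').mk)) ≫ (FHom.gamma a a' (b ⊗ b')).mk =
        ((FHom.gamma a a' b).mk ⊗ₘ (FHom.gamma a a' b').mk) ≫ (FHom.delta (a ⊗ a') b b').mk
      rw [Category.assoc, h, reassoc_of% tensorμ_tensorμ])

variable (A B) in
/-- The symmetric monoidal functor `η : A → [B, A ⊗ B]`. -/
def eta : LaxBraidedFunctor A (LaxBraidedFunctor B (Tens A B)) where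
  toFunctor :=
    { obj := etaObj A B
      map := etaMap B
      map_id := fun a => nat_ext fun b => FHom.sound (FRel.mapLeft_id a b)
      map_comp := fun f g => nat_ext fun b => FHom.sound (FRel.mapLeft_comp f g b) }
  laxBraided :=
    { ε := etaUnit A B
      μ := etaTensor B
      μ_natural_left := fun {a a'} f x => nat_ext fun b => by
        have h : (FHom.mapLeft f b).mk ▷ Tens.of x b ≫ (FHom.gamma a' x b).mk =
          (FHom.gamma a x b).mk ≫ (FHom.mapLeft (f ▷ x) b).mk :=
            FHom.sound (FRel.gamma_natural_left f x b)
        rw [← tensorHom_id] at h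
        exact h
      μ_natural_right := fun {a a'} x f => nat_ext fun b => by
        have h : Tens.of x b ◁ (FHom.mapLeft f b).mk ≫ (FHom.gamma x a' b).mk =
          (FHom.gamma x a b).mk ≫ (FHom.mapLeft (x ◁ f) b).mk :=
            FHom.sound (FRel.gamma_natural_middle x f b)
        rw [← id_tensorHom] at h
        exact h
      associativity := fun x y z => nat_ext fun b => by
        have h : (FHom.gamma x y b).mk ▷ Tens.of z b ≫ (FHom.gamma (x ⊗ y) z b).mk ≫
            (FHom.mapLeft (α_ x y z).hom b).mk =
          (α_ (Tens.of x b) (Tens.of y b) (Tens.of z b)).hom ≫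
            Tens.of x b ◁ (FHom.gamma y z b).mk ≫ (FHom.gamma x (y ⊗ z) b).mk :=
            FHom.sound (FRel.gamma_assoc x y z b)
        rw [← tensorHom_id, ← id_tensorHom] at h
        exact h
      left_unitality := fun x => nat_ext fun b => by
        have h : (λ_ (Tens.of x b)).hom = (FHom.alpha b).mk ▷ Tens.of x b ≫
            (FHom.gamma (𝟙_ A) x b).mk ≫ (FHom.mapLeft (λ_ x).hom b).mk :=
            FHom.sound (FRel.gamma_left x b)
        rw [← tensorHom_id] at h
        exact h
      right_unitality := fun x => nat_ext fun b => by
        have h : (ρ_ (Tens.of x b)).hom = Tens.of x b ◁ (FHom.alpha b).mk ≫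
            (FHom.gamma x (𝟙_ A) b).mk ≫ (FHom.mapLeft (ρ_ x).hom b).mk :=
            FHom.sound (FRel.gamma_right x b)
        rw [← id_tensorHom] at h
        exact h
      braided := fun x y => nat_ext fun b => FHom.sound (FRel.gamma_symm x y b) }

/-! ### The strict symmetric monoidal functor `A ⊗ B → C` induced by `F : A → [B, C]` -/

section Eval

variable (F : LaxBraidedFunctor A (LaxBraidedFunctor B C))

/-- The object map of `F̄`. -/
def evalObj : Tens A B → C
  | .unit => 𝟙_ C
  | .of a b => (F.obj a).obj b
  | .tensor X Y => evalObj X ⊗ evalObj Y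

/-- The value of `F̄` on formal arrows. -/
def evalHom : ∀ {X Y : Tens A B}, FHom A B X Y → (evalObj F X ⟶ evalObj F Y)
  | _, _, .id X => 𝟙 (evalObj F X)
  | _, _, .comp p q => evalHom p ≫ evalHom q
  | _, _, .whiskerLeft X p => evalObj F X ◁ evalHom p
  | _, _, .whiskerRight p X => evalHom p ▷ evalObj F X
  | _, _, .assoc X Y Z => (α_ (evalObj F X) (evalObj F Y) (evalObj F Z)).hom
  | _, _, .assocInv X Y Z => (α_ (evalObj F X) (evalObj F Y) (evalObj F Z)).inv
  | _, _, .left X => (λ_ (evalObj F X)).hom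
  | _, _, .leftInv X => (λ_ (evalObj F X)).inv
  | _, _, .right X => (ρ_ (evalObj F X)).hom
  | _, _, .rightInv X => (ρ_ (evalObj F X)).inv
  | _, _, .symm X Y => (β_ (evalObj F X) (evalObj F Y)).hom
  | _, _, .alpha b => unitAt F b
  | _, _, .beta a => ε (F.obj a).toFunctor
  | _, _, .gamma a a' b => tensorAt F a a' b
  | _, _, .delta a b b' => μ (F.obj a).toFunctor b b'
  | _, _, .mapLeft f b => mapAt F f b
  | _, _, .mapRight a g => (F.obj a).map g

theorem evalHom_tens {X Y X' Y' : Tens A B} (p : FHom A B X Y) (q : FHom A B X' Y') :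
    evalHom F (p.tens q) = evalHom F p ⊗ₘ evalHom F q :=
  (MonoidalCategory.tensorHom_def _ _).symm

theorem evalHom_middle (X Y Z W : Tens A B) : evalHom F (FHom.middle X Y Z W) =
    tensorμ (evalObj F X) (evalObj F Y) (evalObj F Z) (evalObj F W) := rfl

/-- `F̄` respects the congruence defining `A ⊗ B`. -/
theorem evalHom_sound {X Y : Tens A B} {p q : FHom A B X Y} (h : FRel p q) :
    evalHom F p = evalHom F q := by
  induction h with
  | refl p => rfl
  | symm' _ ih => exact ih.symm
  | trans _ _ ih₁ ih₂ => exact ih₁.trans ih₂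
  | comp_congr _ _ ih₁ ih₂ => exact congrArg₂ (· ≫ ·) ih₁ ih₂
  | whiskerLeft_congr X _ ih => exact congrArg (evalObj F X ◁ ·) ih
  | whiskerRight_congr X _ ih => exact congrArg (· ▷ evalObj F X) ih
  | id_comp p => exact Category.id_comp _
  | comp_id p => exact Category.comp_id _
  | comp_assoc p q r => exact Category.assoc _ _ _
  | whiskerLeft_id X Y => exact MonoidalCategory.whiskerLeft_id _ _
  | whiskerLeft_comp X p q => exact MonoidalCategory.whiskerLeft_comp _ _ _
  | id_whiskerRight X Y => exact MonoidalCategory.id_whiskerRight _ _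
  | comp_whiskerRight p q W => exact MonoidalCategory.comp_whiskerRight _ _ _
  | exchange t s => exact MonoidalCategory.whisker_exchange _ _
  | assoc_assocInv X Y Z => exact Iso.hom_inv_id _
  | assocInv_assoc X Y Z => exact Iso.inv_hom_id _
  | left_leftInv X => exact Iso.hom_inv_id _
  | leftInv_left X => exact Iso.inv_hom_id _
  | right_rightInv X => exact Iso.hom_inv_id _
  | rightInv_right X => exact Iso.inv_hom_id _
  | symm_symm X Y => exact SymmetricCategory.symmetry _ _
  | pentagon X Y Z W => exact MonoidalCategory.pentagon _ _ _ _
  | triangle X Y => exact MonoidalCategory.triangle _ _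
  | symm_left X => exact braiding_leftUnitor _
  | hexagon X Y Z => exact BraidedCategory.hexagon_reverse _ _ _
  | assoc_natural_left p Y Z => exact associator_naturality_left _ _ _
  | assoc_natural_middle X p Z => exact associator_naturality_middle _ _ _
  | assoc_natural_right X Y p => exact associator_naturality_right _ _ _
  | left_natural p => exact leftUnitor_naturality _
  | right_natural p => exact rightUnitor_naturality _
  | symm_natural_left p Y => exact BraidedCategory.braiding_naturality_left _ _
  | symm_natural_right X p => exact BraidedCategory.braiding_naturality_right _ _
  | mapRight_comp a f g => exact (F.obj a).map_comp f g
  | mapLeft_comp f g b => exact mapAt_comp F f g b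
  | mapRight_id a b => exact (F.obj a).map_id b
  | mapLeft_id a b => exact mapAt_id F a b
  | map_exchange f g => exact (mapAt_naturality F f g).symm
  | alpha_natural g => exact unitAt_naturality F g
  | beta_natural f => exact mapAt_unit F f
  | gamma_natural_left f a b => exact tensorAt_natural_left F f a b
  | gamma_natural_middle a f b => exact tensorAt_natural_right F a f b
  | gamma_natural_right a a' g =>
    exact (congrArg (· ≫ _) (evalHom_tens F _ _)).trans (tensorAt_naturality F a a' g)
  | delta_natural_left f b b' =>
    exact (congrArg (· ≫ _) (evalHom_tens F _ _)).trans (mapAt_tensor F f b b').symm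
  | delta_natural_middle a g b => exact μ_natural_left (F.obj a).toFunctor g b
  | delta_natural_right a b g => exact μ_natural_right (F.obj a).toFunctor b g
  | delta_assoc a b b' b'' => exact associativity (F.obj a).toFunctor b b' b''
  | delta_right a b => exact right_unitality (F.obj a).toFunctor b
  | delta_left a b => exact left_unitality (F.obj a).toFunctor b
  | delta_symm a b b' => exact Functor.LaxBraided.braided (F := (F.obj a).toFunctor) b b'
  | gamma_assoc a a' a'' b => exact tensorAt_associativity F a a' a'' b
  | gamma_right a b => exact tensorAt_right_unitality F a b
  | gamma_left a b => exact tensorAt_left_unitality F a b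
  | gamma_symm a a' b => exact tensorAt_braided F a a' b
  | alpha_delta b b' =>
    exact (congrArg (· ≫ _) (evalHom_tens F _ _)).trans (unitAt_tensor F b b')
  | beta_gamma a a' =>
    exact (congrArg (· ≫ _) (evalHom_tens F _ _)).trans (tensorAt_unit F a a')
  | beta_alpha => exact (unitAt_unit F).symm
  | delta_gamma a a' b b' =>
    have h := tensorAt_tensor F a a' b b'
    have h' := congrArg (tensorμ ((F.obj a).obj b) ((F.obj a).obj b') ((F.obj a').obj b)
      ((F.obj a').obj b') ≫ ·) h
    simp only [reassoc_of% tensorμ_tensorμ] at h'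
    exact ((congrArg (· ≫ _) (evalHom_tens F _ _)).trans h').trans
      (congrArg (_ ≫ ·) (congrArg (· ≫ _) (evalHom_tens F _ _))).symm

/-- The strict symmetric monoidal functor `En F = F̄ : A ⊗ B → C` induced by `F : A → [B, C]`. Its
structure arrows `F̄⁰` and `F̄²` are identities. -/
def En : LaxBraidedFunctor (Tens A B) C where
  toFunctor :=
    { obj := evalObj F
      map := fun {X Y} => Quotient.lift (evalHom F (X := X) (Y := Y)) (fun _ _ => evalHom_sound F)
      map_id := fun _ => rfl
      map_comp := by rintro X Y Z ⟨p⟩ ⟨q⟩; rfl }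
  laxBraided :=
    { ε := 𝟙 (𝟙_ C)
      μ := fun X Y => 𝟙 (evalObj F X ⊗ evalObj F Y)
      μ_natural_left := by
        rintro X Y ⟨p⟩ Z
        exact (Category.comp_id _).trans (Category.id_comp _).symm
      μ_natural_right := by
        rintro X Y Z ⟨p⟩
        exact (Category.comp_id _).trans (Category.id_comp _).symm
      associativity := fun X Y Z => by
        change 𝟙 (evalObj F X ⊗ evalObj F Y) ▷ evalObj F Z ≫
          𝟙 ((evalObj F X ⊗ evalObj F Y) ⊗ evalObj F Z) ≫
            (α_ (evalObj F X) (evalObj F Y) (evalObj F Z)).hom =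
          (α_ (evalObj F X) (evalObj F Y) (evalObj F Z)).hom ≫
            evalObj F X ◁ 𝟙 (evalObj F Y ⊗ evalObj F Z) ≫ 𝟙 _
        simp
      left_unitality := fun X => by
        change (λ_ (evalObj F X)).hom = 𝟙 (𝟙_ C) ▷ evalObj F X ≫
          𝟙 (𝟙_ C ⊗ evalObj F X) ≫ (λ_ (evalObj F X)).hom
        simp
      right_unitality := fun X => by
        change (ρ_ (evalObj F X)).hom = evalObj F X ◁ 𝟙 (𝟙_ C) ≫
          𝟙 (evalObj F X ⊗ 𝟙_ C) ≫ (ρ_ (evalObj F X)).hom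
        simp
      braided := fun X Y => (Category.id_comp _).trans (Category.comp_id _).symm }

end Eval

variable (A B) in
/-- The symmetry `S_{A,B} : A ⊗ B → B ⊗ A`: the strict symmetric monoidal functor that corresponds
to the dual `η^* : A → [B, B ⊗ A]` of `η : B → [A, B ⊗ A]`. -/
def symmFun : LaxBraidedFunctor (Tens A B) (Tens B A) := En (dual (eta B A))

end Tensor

/-! ### The category `SMC` -/

/-- A small symmetric monoidal category. -/
structure SMC where
  /-- The set of objects. -/
  carrier : Type u
  [category : SmallCategory carrier]
  [monoidal : MonoidalCategory carrier]
  [symmetric : SymmetricCategory carrier]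

attribute [instance] SMC.category SMC.monoidal SMC.symmetric

/-- The category of small symmetric monoidal categories and symmetric monoidal functors (the
1-cells of `SMC`). -/
instance : Category SMC.{u} where
  Hom A B := LaxBraidedFunctor A.carrier B.carrier
  id A := idFun A.carrier
  comp F G := compFun F G
  id_comp F := id_compFun F
  comp_id F := comp_idFun F
  assoc F G H := compFun_assoc F G H

/-- The tensor `A ⊗ B` in `SMC`. -/
def SMC.tensor (A B : SMC.{u}) : SMC.{u} where
  carrier := Tens A.carrier B.carrier

/-- The 1-cell `S_{A,B} : A ⊗ B → B ⊗ A` of `SMC`. -/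
def SMC.symm (A B : SMC.{u}) : A.tensor B ⟶ B.tensor A :=
  symmFun A.carrier B.carrier

end SymMon

namespace SymMon

section Symmetry

variable {A B : Type u} [SmallCategory A] [MonoidalCategory A] [SymmetricCategory A]
  [SmallCategory B] [MonoidalCategory B] [SymmetricCategory B]

/-! Taking the dual of a functor `A → [B, C]` exchanges its two arguments together with the
corresponding structure arrows, so doing it twice changes nothing. Under the universal property,
`S_{B,A} ∘ S_{A,B}` is the strict functor that corresponds to the double dual of `η_{A,B}`, that is,
to `η_{A,B}` itself, and this functor is the identity by uniqueness.

The proof carries out this uniqueness argument directly on the presentation of `A ⊗ B`. On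
generators, `S_{A,B}` sends `a ⊗ b` to `b ⊗ a`, exchanges `α` with `β`, `γ` with `δ`, and `f ⊗ b`
with `b ⊗ f`; the reverse symmetry undoes each exchange. Both functors are strict, so they preserve
words, canonical arrows, composites and the expansions `X ⊗ -`, `- ⊗ X`. Hence the composite fixes
every word, by induction on words (`symmFun_symmFun_obj`), and every class of formal arrows, by
induction on a representative (`symmFun_symmFun_map_mk`). Its structure arrows are composites of
identities.

The one technical point is that the composite fixes an arbitrary word `X` only up to a proved
equality: the terms unfold to each other on generators, but not when `X` is a variable. An arrow and
its image therefore lie in different hom-types, and they are compared by heterogeneous equality. The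
relations of the congruence play no role in the induction, because the functors are already defined
on the quotient and each arrow needs only one representative. -/

/-- Two symmetric monoidal functors are equal as soon as they agree on objects, on arrows and on
structure arrows. -/
theorem fun_hext (F G : LaxBraidedFunctor A B) (hobj : ∀ X, F.obj X = G.obj X)
    (hmap : ∀ {X Y : A} (f : X ⟶ Y), F.map f ≍ G.map f)
    (hε : ε F.toFunctor ≍ ε G.toFunctor)
    (hμ : ∀ X Y, μ F.toFunctor X Y ≍ μ G.toFunctor X Y) : F = G := by
  obtain ⟨F, hF⟩ := F
  obtain ⟨G, hG⟩ := G
  -- Once the underlying functors are identified, the structure arrows of both sides have the same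
  -- types, and the heterogeneous hypotheses become ordinary equalities.
  obtain rfl : F = G := CategoryTheory.Functor.hext hobj fun _ _ f => hmap f
  exact fun_ext_of_toFunctor_eq F _ _ (eq_of_heq hε)
    (funext fun X => funext fun Y => eq_of_heq (hμ X Y))

/-! ### Congruence of composition and whiskering for heterogeneous equality -/

/-- This and the two whiskering lemmas below serve the inductive steps on formal arrows, where the
endpoints agree only propositionally. The endpoints are variables here, so the equalities can be
substituted away; in the application they are compound terms such as `(symmFun B A).obj ((symmFun A
B).obj X)`. -/
theorem comp_hcongr {C : Type*} [Category* C] {X Y Z X' Y' Z' : C}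
    {f : X ⟶ Y} {g : Y ⟶ Z} {f' : X' ⟶ Y'} {g' : Y' ⟶ Z'}
    (hX : X = X') (hY : Y = Y') (hZ : Z = Z') (hf : f ≍ f') (hg : g ≍ g') :
    f ≫ g ≍ f' ≫ g' := by
  subst hX hY hZ hf hg; rfl

theorem whiskerLeft_hcongr {C : Type*} [Category* C] [MonoidalCategory C]
    {X Y Z X' Y' Z' : C} {f : Y ⟶ Z} {f' : Y' ⟶ Z'}
    (hX : X = X') (hY : Y = Y') (hZ : Z = Z') (hf : f ≍ f') : X ◁ f ≍ X' ◁ f' := by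
  subst hX hY hZ hf; rfl

theorem whiskerRight_hcongr {C : Type*} [Category* C] [MonoidalCategory C]
    {X Y Z X' Y' Z' : C} {f : Y ⟶ Z} {f' : Y' ⟶ Z'}
    (hX : X = X') (hY : Y = Y') (hZ : Z = Z') (hf : f ≍ f') : f ▷ X ≍ f' ▷ X' := by
  subst hX hY hZ hf; rfl

/-! ### The double symmetry on words and on arrows -/

/-- `S_{B,A} ∘ S_{A,B}` is the identity on objects. -/
theorem symmFun_symmFun_obj (X : Tens A B) :
    (symmFun B A).obj ((symmFun A B).obj X) = X := by
  induction X with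
  | unit => rfl
  | of a b => rfl
  -- By strictness, the image of `X ⊗ Y` unfolds to the tensor of the images.
  | tensor X Y hX hY => exact congrArg₂ Tens.tensor hX hY

/-- On the class of a formal arrow, strictness with respect to whiskering is a clause of `evalHom`,
so it holds by definition once a representative is chosen. The version for an arbitrary arrow is
needed because the second symmetry is applied to the value of the first one, an arrow of the
quotient that comes without a chosen representative. -/
theorem symmFun_map_whiskerLeft (X : Tens A B) {Y Z : Tens A B} (f : Y ⟶ Z) :
    (symmFun A B).map (X ◁ f) = (symmFun A B).obj X ◁ (symmFun A B).map f := by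
  obtain ⟨p, rfl⟩ := FHom.mk_surj f
  rfl

theorem symmFun_map_whiskerRight {Y Z : Tens A B} (f : Y ⟶ Z) (X : Tens A B) :
    (symmFun A B).map (f ▷ X) = (symmFun A B).map f ▷ (symmFun A B).obj X := by
  obtain ⟨p, rfl⟩ := FHom.mk_surj f
  rfl

/-- `S_{B,A} ∘ S_{A,B}` is the identity on arrows. -/
theorem symmFun_symmFun_map_mk {X Y : Tens A B} (p : FHom A B X Y) :
    (symmFun B A).map ((symmFun A B).map p.mk) ≍ p.mk := by
  have e (X : Tens A B) := symmFun_symmFun_obj X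
  -- This settles all the canonical arrows at once. Each is a member of a family `c` indexed by at
  -- most three words, and two strict functors carry the member at `X, Y, Z` to the member at their
  -- images by definition, so only the indices have to be rewritten. Families with fewer indices
  -- ignore the remaining slots, which are filled by repeating a word.
  have canonical {P : Tens A B → Tens A B → Tens A B → Type u}
      (c : ∀ X Y Z, P X Y Z) (X Y Z : Tens A B) :
      c ((symmFun B A).obj ((symmFun A B).obj X)) ((symmFun B A).obj ((symmFun A B).obj Y))
        ((symmFun B A).obj ((symmFun A B).obj Z)) ≍ c X Y Z := by
    rw [e, e, e]
  induction p with
  | id X => exact canonical (fun X _ _ => 𝟙 X) X X X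
  | comp p q hp hq =>
    -- The first symmetry acts on an explicit formal composite, so it distributes over it by
    -- definition. The second needs a lemma, here functoriality, and in the next two cases
    -- strictness for whiskering with the roles of `A` and `B` exchanged.
    change (symmFun B A).map ((symmFun A B).map p.mk ≫ (symmFun A B).map q.mk) ≍ p.mk ≫ q.mk
    rw [(symmFun B A).map_comp]
    exact comp_hcongr (e _) (e _) (e _) hp hq
  | whiskerLeft X p hp =>
    change (symmFun B A).map ((symmFun A B).obj X ◁ (symmFun A B).map p.mk) ≍ X ◁ p.mk
    rw [symmFun_map_whiskerLeft]
    exact whiskerLeft_hcongr (e _) (e _) (e _) hp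
  | whiskerRight p X hp =>
    change (symmFun B A).map ((symmFun A B).map p.mk ▷ (symmFun A B).obj X) ≍ p.mk ▷ X
    rw [symmFun_map_whiskerRight]
    exact whiskerRight_hcongr (e _) (e _) (e _) hp
  | assoc X Y Z => exact canonical (fun X Y Z => (α_ X Y Z).hom) X Y Z
  | assocInv X Y Z => exact canonical (fun X Y Z => (α_ X Y Z).inv) X Y Z
  | left X => exact canonical (fun X _ _ => (λ_ X).hom) X X X
  | leftInv X => exact canonical (fun X _ _ => (λ_ X).inv) X X X
  | right X => exact canonical (fun X _ _ => (ρ_ X).hom) X X X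
  | rightInv X => exact canonical (fun X _ _ => (ρ_ X).inv) X X X
  | symm X Y => exact canonical (fun X Y _ => (β_ X Y).hom) X Y Y
  -- Here the double dual unfolds: `α_b` goes to `β_b` of `B ⊗ A` and back to `α_b`, `γ_{a,a',b}`
  -- goes to `δ_{b,a,a'}` and back, `f ⊗ b` goes to `b ⊗ f` and back, and likewise for `β`, `δ` and
  -- `a ⊗ g`. The endpoints are explicit generators, so even the hom-types agree by definition.
  | alpha b => rfl
  | beta a => rfl
  | gamma a a' b => rfl
  | delta a b b' => rfl
  | mapLeft f b => rfl
  | mapRight a g => rfl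

/-! ### The double symmetry as a symmetric monoidal functor -/

/-- `S_{B,A} ∘ S_{A,B}` is the identity. -/
theorem compFun_symmFun_symmFun : compFun (symmFun A B) (symmFun B A) = idFun (Tens A B) := by
  refine fun_hext _ _ symmFun_symmFun_obj (fun f => ?_) ?_ fun X Y => ?_
  · obtain ⟨p, rfl⟩ := FHom.mk_surj f
    exact symmFun_symmFun_map_mk p
  -- The unit arrow of a composite is `G⁰` followed by `G(F⁰)`, and both factors are identities. The
  -- word `I` is fixed by definition, so an ordinary equality is enough.
  · change 𝟙 (𝟙_ (Tens A B)) ≫ (symmFun B A).map (𝟙 ((symmFun A B).obj (𝟙_ (Tens A B)))) ≍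
      𝟙 (𝟙_ (Tens A B))
    rw [(symmFun B A).map_id]
    exact heq_of_eq (Category.comp_id _)
  -- By strictness, the source and target of this binary structure arrow both unfold to the image of
  -- the whole word `X ⊗ Y`. Written in this way it collapses to one identity arrow, and a single
  -- rewrite along the equality of objects moves it to `X ⊗ Y`.
  · change 𝟙 ((symmFun B A).obj ((symmFun A B).obj (X ⊗ Y))) ≫
      (symmFun B A).map (𝟙 ((symmFun A B).obj (X ⊗ Y))) ≍ 𝟙 (X ⊗ Y)
    rw [(symmFun B A).map_id, Category.comp_id, symmFun_symmFun_obj]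

end Symmetry

end SymMon

/-- Composition and identities of `SMC` unfold to `compFun` and `idFun`, with `≫` in diagrammatic
order, so the left-hand side is `S_{B,A} ∘ S_{A,B}` with its structure arrows included. -/
theorem mainTheorem9 (A B : SymMon.SMC.{u}) :
    A.symm B ≫ B.symm A = 𝟙 (A.tensor B) :=
  SymMon.compFun_symmFun_symmFun
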